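/- **Setting.** Let $\mathcal P=(V,\prec)$ be a finite poset with $n=|V|$ and width $k$ (largest size of an antichain). For $X\subseteq V$ let $k_X$ be the width of $(X,\prec)$, and for $p\in X$ let $X_{\prec p}$, $X_{\succ p}$ be the sets of elements of $X$ smaller, respectively larger, than $p$. Let $G=(V,E)$ be a query graph, deterministic or random (with a distribution independent of all coins of the algorithms). An algorithm may query a pair $(u,v)\in E$ and learns whether $u\prec v$, $v\prec u$, or $u,v$ are incomparable. Let $\vec G$ have an arc $u\to v$ whenever $(u,v)\in E$ and $u\prec v$, and assume (always) that $\vec G$ induces $\mathcal P$: $u\prec v$ if and only if there is a directed path of positive length from $u$ to $v$ in $\vec G$. A partition procedure $\textsc{Partition}(G[X],p)$ ($X\subseteq V$, $p\in X$) is a randomized algorithm whose input is the induced subgraph $G[X]$ and the pivot $p$, which queries edges of $G[X]$, and which outputs three subsets of $X\setminus\{p\}$. Its output is correct if these are $L_{X,p}$, $M_{X,p}$, $R_{X,p}$: the sets of $u\in X\setminus\{p\}$ that can reach $p$ in $\vec G[X]$, that neither reach $p$ nor are reached from $p$ in $\vec G[X]$, and that can be reached from $p$ in $\vec G[X]$,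 respectively. $\textsc{Part-to-LE}(X)$ returns the empty sequence if $X=\varnothing$; otherwise it picks a uniformly random pivot $p\in X$, calls $\textsc{Partition}(G[X],p)$ with fresh randomness to get $(L,M,R)$, and returns the concatenation $\textsc{Part-to-LE}(L)\,\|\,p\,\|\,\textsc{Part-to-LE}(M)\,\|\,\textsc{Part-to-LE}(R)$. A linear extension of $\mathcal P$ is an enumeration $p_1,\dots,p_n$ of $V$ with $p_i\nsucc p_j$ for all $i<j$. **Statement.** For every constant $c>0$ there is a constant $C>0$, depending only on $c$, such that for all $\mathcal P$, $G$, $\textsc{Partition}$ as above and every function $f\ge 0$ of $n,k$ the following hold. 1. Let $\varepsilon$ be real. If for every $X\subseteq V$ and $p\in X$, with probability at least $1-\varepsilon$, $\textsc{Partition}(G[X],p)$ outputs $L_{X,p},M_{X,p},R_{X,p}$ correctly and makes at most $c\,|X|\,(k_{X_{\prec p}}+k_{X_{\succ p}})\,f(n,k)$ queries, then with probability at least $1-n\varepsilon-2n^{-6}$, $\textsc{Part-to-LE}(V)$ outputs a linear extension of $\mathcal P$ and makes at most $C\,n\,k\,f(n,k)\log^2 n$ queries. 2. If for every $X\subseteq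 V$ and $p\in X$, $\textsc{Partition}(G[X],p)$ always outputs $L_{X,p},M_{X,p},R_{X,p}$ correctly and makes at most $c\,|X|\,(k_{X_{\prec p}}+k_{X_{\succ p}})\,f(n,k)$ queries in expectation, then $\textsc{Part-to-LE}(V)$ always outputs a linear extension of $\mathcal P$, and it makes at most $C\,n\,k\,f(n,k)\log^2 n$ queries in expectation. (For $n=0$ read $n^{-6}$ and $\log n$ as $0$.) -/

import Mathlib

open scoped ENNReal

universe u

noncomputable section

namespace PosetSort

/-! ### Randomized query algorithms -/

/-- The three possible relations of an ordered pair `(u, v)`: `u ≺ v`, `v ≺ u`, or `u ≁ v`. -/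
inductive Rel : Type
  | prec
  | succ
  | incomp

/-- Randomized algorithms that may query the elements of `Q` and return an element of `α`.
An algorithm returns a value, or makes one query and continues according to the answer,
or draws a fresh random value from a discrete distribution and continues according to it. -/
inductive QueryAlg (Q α : Type u) : Type (u + 1)
  | ret (a : α) : QueryAlg Q α
  | query (q : Q) (next : Rel → QueryAlg Q α) : QueryAlg Q α
  | sample {ι : Type u} (d : PMF ι) (next : ι → QueryAlg Q α) : QueryAlg Q α

namespace QueryAlg

variable {Q Q' α β : Type u}

/-- Sequential composition: run the first algorithm, then the one selected by its result. -/
def bind : QueryAlg Q α → (α → QueryAlg Q β) → QueryAlg Q β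
  | ret a, g => g a
  | query q next, g => query q fun r => (next r).bind g
  | sample d next, g => sample d fun i => (next i).bind g

/-- Rename the queries. -/
def mapQuery (φ : Q → Q') : QueryAlg Q α → QueryAlg Q' α
  | ret a => ret a
  | query q next => query (φ q) fun r => (next r).mapQuery φ
  | sample d next => sample d fun i => (next i).mapQuery φ

/-- The joint law of the output and of the number of queries, when the queries are answered
by the oracle `O`. Every query is counted, repeated ones too. -/
def run (O : Q → Rel) : QueryAlg Q α → PMF (α × ℕ)
  | ret a => PMF.pure (a, 0)
  | query q next => ((next (O q)).run O).map fun r => (r.1, r.2 + 1)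
  | sample d next => d.bind fun i => (next i).run O

end QueryAlg

/-! ### Posets and query graphs -/

section Graphs

variable {W : Type u} [PartialOrder W]

/-- The arcs of the directed graph obtained from `H` by orienting each edge between comparable
vertices from the smaller to the larger one; edges between incomparable vertices are dropped. -/
def Arc (H : SimpleGraph W) (u v : W) : Prop := H.Adj u v ∧ u < v

/-- `u` can reach `v` by a directed path (possibly of length zero). -/
def CanReach (H : SimpleGraph W) (u v : W) : Prop := Relation.ReflTransGen (Arc H) u v

/-- The poset is the one induced by the oriented query graph: `u ≺ v` iff there is a directed
path of positive length from `u` to `v`. -/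
def InducesOrder (H : SimpleGraph W) : Prop :=
  ∀ u v : W, u < v ↔ Relation.TransGen (Arc H) u v

open Classical in
/-- The oracle: the ordered pair `(u, v)` of adjacent vertices is answered by the relation of `u`
and `v` in the poset. As `u` and `v` are adjacent, this is also their reachability relation in
the oriented graph. -/
def oracle (H : SimpleGraph W) (d : H.Dart) : Rel :=
  if d.fst < d.snd then Rel.prec else if d.snd < d.fst then Rel.succ else Rel.incomp

open Classical in
/-- The width of the subposet on `X`: the largest size of an antichain contained in `X`. -/
def width (X : Finset W) : ℕ :=
  (X.powerset.filter fun S : Finset W => IsAntichain (· ≤ ·) (S : Set W)).sup Finset.card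

open Classical in
/-- The elements of `X` that are smaller than `p`. -/
def below (X : Finset W) (p : W) : Finset W := X.filter fun u => u < p

open Classical in
/-- The elements of `X` that are larger than `p`. -/
def above (X : Finset W) (p : W) : Finset W := X.filter fun u => p < u

/-- A list is a linear extension if it enumerates all elements without repetition and no
element is preceded by a larger one. -/
def IsLinearExtension (l : List W) : Prop :=
  l.Nodup ∧ (∀ v, v ∈ l) ∧ l.Pairwise fun a b => ¬ b < a

end Graphs

/-- The induced subgraph on `X`, as a graph with vertex set `X`. -/
def inducedOn {V : Type u} (G : SimpleGraph V) (X : Finset V) : SimpleGraph X :=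
  G.comap Subtype.val

/-- An edge of the induced subgraph, seen as an edge of the whole graph. -/
def liftDart {V : Type u} (G : SimpleGraph V) (X : Finset V) (d : (inducedOn G X).Dart) :
    G.Dart :=
  ⟨(d.fst.1, d.snd.1), d.adj⟩

/-! ### Partition algorithms -/

/-- The output format of a partition algorithm with pivot `p`: three sets of vertices other than
`p`. (An incorrect output may be any three such sets, overlapping or not.) -/
@[ext] structure Parts {W : Type u} (p : W) : Type u where
  lower : Finset W
  middle : Finset W
  upper : Finset W
  notMem_lower : p ∉ lower
  notMem_middle : p ∉ middle
  notMem_upper : p ∉ upper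

/-- The output is correct: the three sets are the vertices other than `p` that can reach `p`,
that neither reach `p` nor are reached from `p`, and that can be reached from `p`. -/
def Parts.Correct {W : Type u} [PartialOrder W] {p : W} (T : Parts p) (H : SimpleGraph W) : Prop :=
  (∀ u, u ∈ T.lower ↔ u ≠ p ∧ CanReach H u p) ∧
  (∀ u, u ∈ T.middle ↔ u ≠ p ∧ ¬ CanReach H u p ∧ ¬ CanReach H p u) ∧
  (∀ u, u ∈ T.upper ↔ u ≠ p ∧ CanReach H p u)

/-- A partition procedure: its input is a graph `H` on a set `X` of vertices, together with a
pivot in `X`, and it may query the edges of `H`. -/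
def PartitionAlg (V : Type u) : Type (u + 1) :=
  ∀ (X : Finset V) (H : SimpleGraph X) (p : X), QueryAlg H.Dart (Parts p)

/-- A set of vertices of the induced subgraph, as a set of vertices of the whole graph. -/
def liftSet {V : Type u} {X : Finset V} (S : Finset X) : Finset V :=
  S.map (Function.Embedding.subtype _)

theorem card_liftSet_lt {V : Type u} {X : Finset V} {p : X} {S : Finset X} (h : p ∉ S) :
    (liftSet S).card < X.card := by
  rw [liftSet, Finset.card_map, ← Fintype.card_coe X]
  exact Finset.card_lt_univ_of_notMem h

open Classical in
/-- The quicksort-like procedure Part-to-LE, for the query graph `G`: choose a uniformly random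
pivot in `X`, partition the induced subgraph on `X`, recurse into the three parts and
concatenate. -/
def partToLE {V : Type u} (A : PartitionAlg V) (G : SimpleGraph V) (X : Finset V) :
    QueryAlg G.Dart (List V) :=
  if h : X.Nonempty then
    haveI : Nonempty X := h.to_subtype
    QueryAlg.sample (PMF.uniformOfFintype X) fun p =>
      ((A X (inducedOn G X) p).mapQuery (liftDart G X)).bind fun T =>
        (partToLE A G (liftSet T.lower)).bind fun l =>
          (partToLE A G (liftSet T.middle)).bind fun m =>
            (partToLE A G (liftSet T.upper)).bind fun r =>
              QueryAlg.ret (l ++ [p.1] ++ m ++ r)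
  else QueryAlg.ret []
termination_by X.card
decreasing_by
  · exact card_liftSet_lt T.notMem_lower
  · exact card_liftSet_lt T.notMem_middle
  · exact card_liftSet_lt T.notMem_upper

/-! ### The random experiments -/

section Laws

variable {V : Type u} [PartialOrder V]

/-- The joint law of the query graph `G`, drawn from `μ`, of the output of the partition
procedure on the induced subgraph on `X` with pivot `p`, and of its number of queries. -/
def partitionLaw (μ : PMF (SimpleGraph V)) (A : PartitionAlg V) (X : Finset V) (p : X) :
    PMF (SimpleGraph V × Parts p × ℕ) :=
  μ.bind fun G =>
    ((A X (inducedOn G X) p).run (oracle (inducedOn G X))).map fun r => (G, r.1, r.2)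

/-- The joint law of the output of Part-to-LE on the whole vertex set and of its total number of
queries, when the query graph is drawn from `μ`. -/
def partToLELaw [Fintype V] (μ : PMF (SimpleGraph V)) (A : PartitionAlg V) : PMF (List V × ℕ) :=
  μ.bind fun G => (partToLE A G Finset.univ).run (oracle G)

end Laws

/-- The expectation, in `[0, ∞]`, of a natural-number-valued random variable. -/
def expect {α : Type u} (P : PMF α) (N : α → ℕ) : ℝ≥0∞ := ∑' a, P a * (N a : ℝ≥0∞)

end PosetSort

end

/-! As long as every partition is correct, the recursion only visits convex sets, and on a convex
`X` reachability inside the induced subgraph is the order itself. The recursion tree is then a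
random object of the poset alone (`treeLaw`), independent of the query graph, and the concatenated
output is a linear extension. `ev_penalty_le` compares a real run with this ideal tree at the price
of the failure probability of each node. Since the tree does not depend on `G`, the average over `G`
can be taken node by node, and since it has exactly `n` nodes the price is `n ε`.

What remains is to bound the sum over the tree of `|X|` times the widths below and above the pivot.
Partition `V` into `k` chains (Dilworth). Each width is at most the number of chains with an element
of `X` on the relevant side of the pivot, and the factor `|X|` is a sum over `v ∈ X`. If `v` is
comparable to the pivot, `2k` is charged to a counter indexed by `v` and a side; otherwise one unit
is charged, for each side and each chain `j` that counts there, to a counter indexed by `v`, the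
side and `j` (`stepCost_le`).

Each counter behaves like a record process along the branch of `v`: when the uniform pivot hits the
current target set, only targets preceding the pivot in an asymmetric relation survive, on average
fewer than half. Hence `2 ^ hits` has expectation at most one plus the number of targets
(`IsCounter.ev_two_pow_hits_le`). Summing over the `2n(k+1)` counters gives a potential of
polynomial mean, and with `r = 11 ⌈log₂ n⌉` the total is at most `6nkr + 2k · 2⁻ʳ · potential`.
Markov's inequality turns this into the tail bound, and taking means gives the expected cost. -/

noncomputable section

namespace PosetSort

/-! ### Width and Dilworth's theorem -/

section Dilworth

variable {W : Type u} [PartialOrder W]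

theorem card_le_width {X S : Finset W} (hS : S ⊆ X) (h : IsAntichain (· ≤ ·) (S : Set W)) :
    S.card ≤ width X := by
  classical
  unfold width
  exact Finset.le_sup (f := Finset.card) (by simp [hS, h])

theorem exists_card_eq_width (X : Finset W) :
    ∃ S ⊆ X, IsAntichain (· ≤ ·) (S : Set W) ∧ S.card = width X := by
  classical
  have hne : (X.powerset.filter fun S : Finset W =>
      IsAntichain (· ≤ ·) (S : Set W)).Nonempty := ⟨∅, by simp⟩
  obtain ⟨S, hS, h⟩ := Finset.exists_mem_eq_sup _ hne Finset.card
  simp only [Finset.mem_filter, Finset.mem_powerset] at hS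
  exact ⟨S, hS.1, hS.2, by rw [← h]; unfold width; congr⟩

theorem width_mono {X Y : Finset W} (h : X ⊆ Y) : width X ≤ width Y := by
  obtain ⟨S, hS, hA, hc⟩ := exists_card_eq_width X
  exact hc ▸ card_le_width (hS.trans h) hA

theorem width_le_card (X : Finset W) : width X ≤ X.card := by
  obtain ⟨S, hS, -, hc⟩ := exists_card_eq_width X
  exact hc ▸ Finset.card_le_card hS

theorem width_empty : width (∅ : Finset W) = 0 :=
  Nat.le_zero.1 (width_le_card ∅)

/-- A colouring whose colour classes are chains uses on `X` at least `width X` colours. -/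
theorem width_le_card_of_coloring {X : Finset W} {χ : W → ℕ} {I : Finset ℕ}
    (hχ : ∀ u ∈ X, ∀ v ∈ X, χ u = χ v → u ≤ v ∨ v ≤ u) (hI : ∀ v ∈ X, χ v ∈ I) :
    width X ≤ I.card := by
  obtain ⟨S, hS, hA, hc⟩ := exists_card_eq_width X
  rw [← hc]
  refine Finset.card_le_card_of_injOn χ (fun v hv => hI v (hS hv)) ?_
  intro u hu v hv huv
  by_contra hne
  rcases hχ u (hS hu) v (hS hv) huv with h | h
  · exact hA hu hv hne h
  · exact hA hv hu (Ne.symm hne) h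

/-- Colours are distinct on an antichain, so by counting a maximum antichain uses all of them. -/
theorem exists_mem_color_of_maximum_antichain {X S : Finset W} {χ : W → ℕ}
    (hlt : ∀ v ∈ X, χ v < width X)
    (hχ : ∀ u ∈ X, ∀ v ∈ X, χ u = χ v → u ≤ v ∨ v ≤ u)
    (hS : S ⊆ X) (hA : IsAntichain (· ≤ ·) (S : Set W)) (hc : width X ≤ S.card)
    {i : ℕ} (hi : i < width X) : ∃ y ∈ S, χ y = i := by
  have hinj : Set.InjOn χ S := by
    intro u hu v hv huv
    by_contra hne
    rcases hχ u (hS hu) v (hS hv) huv with h | h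
    · exact hA hu hv hne h
    · exact hA hv hu (Ne.symm hne) h
  have := Finset.surj_on_of_inj_on_of_card_le (s := S) (t := Finset.range (width X))
    (fun v _ => χ v) (fun v hv => Finset.mem_range.2 (hlt v (hS hv)))
    (fun u v hu hv h => hinj hu hv h) (by simpa using hc) i (Finset.mem_range.2 hi)
  obtain ⟨y, hy, h⟩ := this
  exact ⟨y, hy, h.symm⟩

/-- **Dilworth's theorem**: a finite poset is covered by as many chains as its width. -/
theorem exists_chain_coloring (X : Finset W) :
    ∃ χ : W → ℕ, (∀ v ∈ X, χ v < width X) ∧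
      ∀ u ∈ X, ∀ v ∈ X, χ u = χ v → u ≤ v ∨ v ≤ u := by
  classical
  induction X using Finset.strongInduction with
  | H X ih =>
  rcases X.eq_empty_or_nonempty with rfl | hne
  · exact ⟨fun _ => 0, by simp, by simp⟩
  obtain ⟨a, haX, hamax⟩ := X.exists_maximal hne
  obtain ⟨χ, hlt, hχ⟩ := ih (X.erase a) (Finset.erase_ssubset haX)
  have hsub : X.erase a ⊆ X := Finset.erase_subset _ _
  rcases (width_mono hsub).lt_or_eq with hw | hw
  · refine ⟨Function.update χ a (width (X.erase a)), ?_, ?_⟩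
    · intro v hv
      by_cases hva : v = a
      · subst hva; simpa using hw
      · rw [Function.update_of_ne hva]
        exact (hlt v (Finset.mem_erase.2 ⟨hva, hv⟩)).trans hw
    · intro u hu v hv huv
      by_cases hua : u = a <;> by_cases hva : v = a
      · subst hua; subst hva; simp
      · subst hua
        rw [Function.update_self, Function.update_of_ne hva] at huv
        exact absurd huv (hlt v (Finset.mem_erase.2 ⟨hva, hv⟩)).ne'
      · subst hva
        rw [Function.update_self, Function.update_of_ne hua] at huv
        exact absurd huv (hlt u (Finset.mem_erase.2 ⟨hua, hu⟩)).ne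
      · rw [Function.update_of_ne hua, Function.update_of_ne hva] at huv
        exact hχ u (Finset.mem_erase.2 ⟨hua, hu⟩) v (Finset.mem_erase.2 ⟨hva, hv⟩) huv
  -- Galvin's argument: the width does not drop when the maximal element `a` is removed, so a chain
  -- through `a` meeting every maximum antichain of `Y` has to be split off.
  · set Y := X.erase a with hY
    set k := width Y with hk
    let IsMax : Finset W → Prop := fun S =>
      S ⊆ Y ∧ IsAntichain (· ≤ ·) (S : Set W) ∧ k ≤ S.card
    obtain ⟨S₀, hS₀Y, hS₀A, hS₀c⟩ := exists_card_eq_width Y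
    have hmeet : ∀ S, IsMax S → ∀ i < k, ∃ y ∈ S, χ y = i := fun S hS i hi =>
      exists_mem_color_of_maximum_antichain hlt hχ hS.1 hS.2.1 hS.2.2 hi
    -- `x i` is the highest element of colour `i` that lies on some maximum antichain of `Y`; for `i
    -- ≥ k` the value is irrelevant.
    have htop : ∀ i, ∃ x, i < k → (x ∈ Y ∧ χ x = i ∧ (∃ S, IsMax S ∧ x ∈ S) ∧
        ∀ S, IsMax S → ∀ y ∈ S, χ y = i → y ≤ x) := by
      intro i
      by_cases hi : i < k
      swap
      · exact ⟨a, fun h => absurd h hi⟩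
      let B := Y.filter fun v => χ v = i ∧ ∃ S, IsMax S ∧ v ∈ S
      have hB : B.Nonempty := by
        obtain ⟨y, hy, hyi⟩ := hmeet S₀ ⟨hS₀Y, hS₀A, hS₀c.ge⟩ i hi
        exact ⟨y, Finset.mem_filter.2 ⟨hS₀Y hy, hyi, S₀, ⟨hS₀Y, hS₀A, hS₀c.ge⟩, hy⟩⟩
      obtain ⟨x, hxB, hxmax⟩ := B.exists_maximal hB
      obtain ⟨hxY, hxi, hxS⟩ := Finset.mem_filter.1 hxB
      refine ⟨x, fun _ => ⟨hxY, hxi, hxS, fun S hS y hy hyi => ?_⟩⟩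
      have hyB : y ∈ B := Finset.mem_filter.2 ⟨hS.1 hy, hyi, S, hS, hy⟩
      rcases hχ y (hS.1 hy) x hxY (hyi.trans hxi.symm) with h | h
      · exact h
      · exact hxmax hyB h
    choose x hx using htop
    -- A maximum antichain through `x j` contains some `y ≤ x i` of colour `i`; then `y ≤ x j`
    -- within one antichain, so they coincide.
    have hxA : ∀ i < k, ∀ j < k, x i ≤ x j → i = j := by
      intro i hi j hj hij
      obtain ⟨S, hS, hxS⟩ := (hx j hj).2.2.1
      obtain ⟨y, hy, hyi⟩ := hmeet S hS i hi
      have hyx := (hx i hi).2.2.2 S hS y hy hyi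
      have : y = x j := by
        by_contra hne
        exact hS.2.1 hy hxS hne (hyx.trans hij)
      rw [← hyi, this, (hx j hj).2.1]
    -- Otherwise `a` together with all the `x i` would be an antichain of size `k + 1`.
    have hcomp : ∃ i < k, x i < a := by
      by_contra! hno
      have hinj : Set.InjOn x (Finset.range k : Set ℕ) := fun i hi j hj h =>
        hxA i (by simpa using hi) j (by simpa using hj) h.le
      have haA : a ∉ (Finset.range k).image x := by
        intro h
        obtain ⟨i, hi, hia⟩ := Finset.mem_image.1 h
        have := (hx i (Finset.mem_range.1 hi)).1
        rw [hia] at this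
        simp [hY] at this
      have hle : (insert a ((Finset.range k).image x)).card ≤ width X := by
        refine card_le_width ?_ ?_
        · intro v hv
          rcases Finset.mem_insert.1 hv with rfl | hv
          · exact haX
          · obtain ⟨i, hi, rfl⟩ := Finset.mem_image.1 hv
            exact hsub (hx i (Finset.mem_range.1 hi)).1
        · intro u hu v hv huv hle
          simp only [Finset.coe_insert, Finset.coe_image, Set.mem_insert_iff, Set.mem_image,
            Finset.mem_coe, Finset.mem_range] at hu hv
          rcases hu with rfl | ⟨i, hi, rfl⟩ <;> rcases hv with rfl | ⟨j, hj, rfl⟩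
          · exact huv rfl
          · exact huv (le_antisymm hle (hamax (hsub (hx j hj).1) hle))
          · exact hno i hi (lt_of_le_of_ne hle huv)
          · exact huv (congrArg x (hxA i hi j hj hle))
      rw [Finset.card_insert_of_notMem haA, Finset.card_image_of_injOn hinj,
        Finset.card_range] at hle
      omega
    obtain ⟨i, hi, hia⟩ := hcomp
    -- `K` cuts out the chain to remove: `a` on top of the part of colour `i` up to `x i`. A
    -- `k`-antichain avoiding it would have its element of colour `i` above `x i`, against the
    -- choice of `x i`.
    let K : W → Prop := fun z => z = a ∨ (χ z = i ∧ z ≤ x i)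
    have hZsub : X.filter (fun z => ¬ K z) ⊂ X :=
      Finset.filter_ssubset.2 ⟨a, haX, fun h => h (Or.inl rfl)⟩
    obtain ⟨ψ, hψlt, hψ⟩ := ih _ hZsub
    have hZw : width (X.filter fun z => ¬ K z) < k := by
      by_contra! hge
      obtain ⟨S, hS, hA, hc⟩ := exists_card_eq_width (X.filter fun z => ¬ K z)
      have hSY : S ⊆ Y := fun z hz => by
        have := Finset.mem_filter.1 (hS hz)
        exact Finset.mem_erase.2 ⟨fun h => this.2 (Or.inl h), this.1⟩
      obtain ⟨y, hy, hyi⟩ := hmeet S ⟨hSY, hA, hc ▸ hge⟩ i hi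
      exact (Finset.mem_filter.1 (hS hy)).2
        (Or.inr ⟨hyi, (hx i hi).2.2.2 S ⟨hSY, hA, hc ▸ hge⟩ y hy hyi⟩)
    have hψlt' : ∀ v ∈ X, ¬ K v → ψ v < k - 1 := fun v hv hK =>
      lt_of_lt_of_le (hψlt v (Finset.mem_filter.2 ⟨hv, hK⟩)) (by omega)
    refine ⟨fun z => if K z then k - 1 else ψ z, ?_, ?_⟩
    · intro v hv
      by_cases hK : K v
      · simp only [hK, if_true]; omega
      · simp only [hK, if_false]
        have := hψlt' v hv hK
        omega
    · intro u hu v hv huv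
      by_cases hKu : K u <;> by_cases hKv : K v
      · rcases hKu with rfl | ⟨hui, hux⟩ <;> rcases hKv with rfl | ⟨hvi, hvx⟩
        · exact Or.inl le_rfl
        · exact Or.inr (hvx.trans hia.le)
        · exact Or.inl (hux.trans hia.le)
        · by_cases hua : u = a
          · exact absurd (hua ▸ hux) hia.not_ge
          by_cases hva : v = a
          · exact absurd (hva ▸ hvx) hia.not_ge
          exact hχ u (Finset.mem_erase.2 ⟨hua, hu⟩) v (Finset.mem_erase.2 ⟨hva, hv⟩)
            (hui.trans hvi.symm)
      · simp only [hKu, hKv, if_true, if_false] at huv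
        exact absurd huv (hψlt' v hv hKv).ne'
      · simp only [hKu, hKv, if_true, if_false] at huv
        exact absurd huv (hψlt' u hu hKu).ne
      · simp only [hKu, hKv, if_false] at huv
        exact hψ u (Finset.mem_filter.2 ⟨hu, hKu⟩) v (Finset.mem_filter.2 ⟨hv, hKv⟩) huv

end Dilworth

/-! ### Expectations over discrete laws, and laws of composed query algorithms -/

section Expectation

variable {α β : Type*}

/-- The expectation of a `[0, ∞]`-valued function of a discrete random variable. -/
def ev (P : PMF α) (Φ : α → ℝ≥0∞) : ℝ≥0∞ := ∑' a, P a * Φ a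

theorem ev_pure (a : α) (Φ : α → ℝ≥0∞) : ev (PMF.pure a) Φ = Φ a := by
  unfold ev
  rw [tsum_eq_single a]
  · simp
  · intro b hb
    simp [PMF.pure_apply, hb]

theorem ev_bind (P : PMF α) (f : α → PMF β) (Φ : β → ℝ≥0∞) :
    ev (P.bind f) Φ = ev P fun a => ev (f a) Φ := by
  simp only [ev, PMF.bind_apply]
  simp_rw [← ENNReal.tsum_mul_right, ← ENNReal.tsum_mul_left]
  rw [ENNReal.tsum_comm]
  simp_rw [mul_assoc]

theorem ev_map (P : PMF α) (f : α → β) (Φ : β → ℝ≥0∞) :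
    ev (P.map f) Φ = ev P fun a => Φ (f a) := by
  rw [← PMF.bind_pure_comp, ev_bind]
  simp [ev_pure]

theorem ev_mono_support {P : PMF α} {Φ Ψ : α → ℝ≥0∞} (h : ∀ a ∈ P.support, Φ a ≤ Ψ a) :
    ev P Φ ≤ ev P Ψ := by
  refine ENNReal.tsum_le_tsum fun a => ?_
  by_cases ha : a ∈ P.support
  · gcongr
    exact h a ha
  · rw [PMF.mem_support_iff, not_not] at ha
    simp [ha]

theorem ev_mono {P : PMF α} {Φ Ψ : α → ℝ≥0∞} (h : ∀ a, Φ a ≤ Ψ a) : ev P Φ ≤ ev P Ψ :=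
  ev_mono_support fun a _ => h a

theorem ev_const (P : PMF α) (c : ℝ≥0∞) : ev P (fun _ => c) = c := by
  unfold ev
  rw [ENNReal.tsum_mul_right, P.tsum_coe, one_mul]

theorem ev_add (P : PMF α) (Φ Ψ : α → ℝ≥0∞) :
    ev P (fun a => Φ a + Ψ a) = ev P Φ + ev P Ψ := by
  simp only [ev, mul_add, ENNReal.tsum_add]

theorem ev_const_mul (P : PMF α) (c : ℝ≥0∞) (Φ : α → ℝ≥0∞) :
    ev P (fun a => c * Φ a) = c * ev P Φ := by
  unfold ev
  rw [← ENNReal.tsum_mul_left]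
  exact tsum_congr fun a => by ring

theorem ev_mul_const (P : PMF α) (c : ℝ≥0∞) (Φ : α → ℝ≥0∞) :
    ev P (fun a => Φ a * c) = ev P Φ * c := by
  simp only [mul_comm _ c, ev_const_mul]

theorem ev_finset_sum {ι : Type*} (P : PMF α) (s : Finset ι) (Φ : ι → α → ℝ≥0∞) :
    ev P (fun a => ∑ i ∈ s, Φ i a) = ∑ i ∈ s, ev P (Φ i) := by
  simp only [ev, Finset.mul_sum]
  exact Summable.tsum_finsetSum fun _ _ => ENNReal.summable

open Classical in
theorem toOuterMeasure_eq_ev (P : PMF α) (s : Set α) :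
    P.toOuterMeasure s = ev P fun a => if a ∈ s then 1 else 0 := by
  rw [PMF.toOuterMeasure_apply]
  refine tsum_congr fun a => ?_
  by_cases ha : a ∈ s <;> simp [ha]

theorem toOuterMeasure_add_compl (P : PMF α) (s : Set α) :
    P.toOuterMeasure s + P.toOuterMeasure sᶜ = 1 := by
  classical
  rw [toOuterMeasure_eq_ev, toOuterMeasure_eq_ev, ← ev_add]
  refine Eq.trans ?_ (ev_const P 1)
  congr 1
  funext a
  by_cases ha : a ∈ s <;> simp [ha]

theorem ev_uniform [Fintype α] [Nonempty α] (Φ : α → ℝ≥0∞) :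
    ev (PMF.uniformOfFintype α) Φ = (Fintype.card α : ℝ≥0∞)⁻¹ * ∑ a, Φ a := by
  simp [ev, tsum_fintype, Finset.mul_sum]

end Expectation

namespace QueryAlg

variable {Q Q' α β : Type u}

theorem run_mapQuery (φ : Q → Q') (O : Q' → Rel) (a : QueryAlg Q α) :
    (a.mapQuery φ).run O = a.run (O ∘ φ) := by
  induction a with
  | ret a => rfl
  | query q next ih => simp only [mapQuery, run, ih]; rfl
  | sample d next ih => simp only [mapQuery, run, ih]

theorem run_bind (O : Q → Rel) (a : QueryAlg Q α) (g : α → QueryAlg Q β) :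
    (a.bind g).run O =
      (a.run O).bind fun r => ((g r.1).run O).map fun s => (s.1, r.2 + s.2) := by
  induction a with
  | ret a =>
    simp only [bind, run, PMF.pure_bind, zero_add]
    exact (PMF.map_id _).symm
  | query q next ih =>
    simp only [bind, run, ih, PMF.map_bind, PMF.bind_map]
    congr 1
    funext r
    simp only [Function.comp_apply, PMF.map_comp]
    congr 1
    funext s
    simp only [Function.comp_apply]
    congr 1
    omega
  | sample d next ih => simp only [bind, run, ih, PMF.bind_bind]

theorem ev_run_bind (O : Q → Rel) (a : QueryAlg Q α) (g : α → QueryAlg Q β)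
    (Φ : β × ℕ → ℝ≥0∞) :
    ev ((a.bind g).run O) Φ =
      ev (a.run O) fun r => ev ((g r.1).run O) fun s => Φ (s.1, r.2 + s.2) := by
  simp only [run_bind, ev_bind, ev_map]

end QueryAlg

theorem mem_liftSet {V : Type u} {X : Finset V} {S : Finset X} {v : V} :
    v ∈ liftSet S ↔ ∃ h : v ∈ X, (⟨v, h⟩ : X) ∈ S := by
  simp [liftSet]

/-! ### Convex vertex sets: reachability equals order, and correct parts concatenate -/

section Convex

variable {V : Type u} [PartialOrder V]

/-- A set of vertices is convex if it contains every element between two of its elements. -/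
def IsConvex (X : Finset V) : Prop := ∀ a ∈ X, ∀ b ∈ X, ∀ c, a < c → c < b → c ∈ X

open Classical in
/-- The elements of `X` that are incomparable to `p`. -/
def beside (X : Finset V) (p : V) : Finset V := X.filter fun u => ¬ u ≤ p ∧ ¬ p ≤ u

theorem mem_below {X : Finset V} {p u : V} : u ∈ below X p ↔ u ∈ X ∧ u < p := by
  simp [below]

theorem mem_above {X : Finset V} {p u : V} : u ∈ above X p ↔ u ∈ X ∧ p < u := by
  simp [above]

theorem mem_beside {X : Finset V} {p u : V} :
    u ∈ beside X p ↔ u ∈ X ∧ ¬ u ≤ p ∧ ¬ p ≤ u := by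
  simp [beside]

theorem below_subset (X : Finset V) (p : V) : below X p ⊆ X := fun _ h => (mem_below.1 h).1

theorem above_subset (X : Finset V) (p : V) : above X p ⊆ X := fun _ h => (mem_above.1 h).1

theorem beside_subset (X : Finset V) (p : V) : beside X p ⊆ X := fun _ h => (mem_beside.1 h).1

theorem IsConvex.below {X : Finset V} (h : IsConvex X) (p : V) : IsConvex (below X p) := by
  intro a ha b hb c hac hcb
  rw [mem_below] at *
  exact ⟨h a ha.1 b hb.1 c hac hcb, hcb.trans hb.2⟩

theorem IsConvex.above {X : Finset V} (h : IsConvex X) (p : V) : IsConvex (above X p) := by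
  intro a ha b hb c hac hcb
  rw [mem_above] at *
  exact ⟨h a ha.1 b hb.1 c hac hcb, ha.2.trans hac⟩

theorem IsConvex.beside {X : Finset V} (h : IsConvex X) (p : V) : IsConvex (beside X p) := by
  intro a ha b hb c hac hcb
  rw [mem_beside] at *
  exact ⟨h a ha.1 b hb.1 c hac hcb, fun hcp => ha.2.1 (hac.le.trans hcp),
    fun hpc => hb.2.2 (hpc.trans hcb.le)⟩

theorem CanReach.le {H : SimpleGraph V} {u v : V} (h : CanReach H u v) : u ≤ v := by
  induction h with
  | refl => exact le_rfl
  | tail _ hbc ih => exact ih.trans hbc.2.le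

/-- The inner vertices of a directed path in `G` lie strictly between its ends, so convexity keeps
the whole path in `X`. -/
theorem InducesOrder.canReach_inducedOn {G : SimpleGraph V} (hG : InducesOrder G)
    {X : Finset V} (hX : IsConvex X) {u v : X} (h : u ≤ v) : CanReach (inducedOn G X) u v := by
  rcases h.eq_or_lt with rfl | h
  · exact Relation.ReflTransGen.refl
  have key : ∀ a : V, Relation.TransGen (Arc G) a v.1 → ∀ ha : a ∈ X,
      CanReach (inducedOn G X) ⟨a, ha⟩ v := by
    intro a hav
    induction hav using Relation.TransGen.head_induction_on with
    | single hab => exact fun ha => Relation.ReflTransGen.single ⟨hab.1, hab.2⟩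
    | head hac hcv ih =>
      intro ha
      have hc := hX _ ha _ v.2 _ hac.2 ((hG _ _).2 hcv)
      have h₁ : Arc (inducedOn G X) ⟨_, ha⟩ ⟨_, hc⟩ := ⟨hac.1, hac.2⟩
      exact Relation.ReflTransGen.head h₁ (ih hc)
  exact key u.1 ((hG _ _).1 h) u.2

theorem InducesOrder.canReach_iff {G : SimpleGraph V} (hG : InducesOrder G)
    {X : Finset V} (hX : IsConvex X) {u v : X} :
    CanReach (inducedOn G X) u v ↔ u.1 ≤ v.1 :=
  ⟨fun h => h.le, fun h => hG.canReach_inducedOn hX h⟩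

variable {G : SimpleGraph V} {X : Finset V} {p : X} {T : Parts p}

theorem Parts.Correct.lift_lower (hT : T.Correct (inducedOn G X)) (hG : InducesOrder G)
    (hX : IsConvex X) : liftSet T.lower = below X p := by
  ext v
  rw [mem_liftSet, mem_below]
  constructor
  · rintro ⟨h, hv⟩
    rw [hT.1, hG.canReach_iff hX] at hv
    exact ⟨h, lt_of_le_of_ne hv.2 fun he => hv.1 (Subtype.ext he)⟩
  · rintro ⟨h, hv⟩
    refine ⟨h, ?_⟩
    rw [hT.1, hG.canReach_iff hX]
    exact ⟨fun he => hv.ne (congrArg Subtype.val he), hv.le⟩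

theorem Parts.Correct.lift_upper (hT : T.Correct (inducedOn G X)) (hG : InducesOrder G)
    (hX : IsConvex X) : liftSet T.upper = above X p := by
  ext v
  rw [mem_liftSet, mem_above]
  constructor
  · rintro ⟨h, hv⟩
    rw [hT.2.2, hG.canReach_iff hX] at hv
    exact ⟨h, lt_of_le_of_ne hv.2 fun he => hv.1 (Subtype.ext he.symm)⟩
  · rintro ⟨h, hv⟩
    refine ⟨h, ?_⟩
    rw [hT.2.2, hG.canReach_iff hX]
    exact ⟨fun he => hv.ne' (congrArg Subtype.val he), hv.le⟩

theorem Parts.Correct.lift_middle (hT : T.Correct (inducedOn G X)) (hG : InducesOrder G)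
    (hX : IsConvex X) : liftSet T.middle = beside X p := by
  ext v
  rw [mem_liftSet, mem_beside]
  constructor
  · rintro ⟨h, hv⟩
    rw [hT.2.1, hG.canReach_iff hX, hG.canReach_iff hX] at hv
    exact ⟨h, hv.2⟩
  · rintro ⟨h, hv⟩
    refine ⟨h, ?_⟩
    rw [hT.2.1, hG.canReach_iff hX, hG.canReach_iff hX]
    exact ⟨fun he => hv.1 (congrArg Subtype.val he).le, hv⟩

/-- A list is a linear extension of the subposet on `X`. -/
def IsLinearExtensionOn (X : Finset V) (l : List V) : Prop :=
  l.Nodup ∧ (∀ v, v ∈ l ↔ v ∈ X) ∧ l.Pairwise fun a b => ¬ b < a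

theorem isLinearExtensionOn_empty : IsLinearExtensionOn (∅ : Finset V) [] := by
  simp [IsLinearExtensionOn]

theorem isLinearExtension_of_univ [Fintype V] {l : List V}
    (h : IsLinearExtensionOn Finset.univ l) : IsLinearExtension l :=
  ⟨h.1, fun v => (h.2.1 v).2 (Finset.mem_univ v), h.2.2⟩

theorem IsLinearExtensionOn.concat {X : Finset V} {p : V} (hp : p ∈ X) {l m r : List V}
    (hl : IsLinearExtensionOn (below X p) l) (hm : IsLinearExtensionOn (beside X p) m)
    (hr : IsLinearExtensionOn (above X p) r) :
    IsLinearExtensionOn X (l ++ [p] ++ m ++ r) := by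
  have hl' : ∀ v, v ∈ l ↔ v ∈ X ∧ v < p := fun v => (hl.2.1 v).trans mem_below
  have hm' : ∀ v, v ∈ m ↔ v ∈ X ∧ ¬ v ≤ p ∧ ¬ p ≤ v := fun v => (hm.2.1 v).trans mem_beside
  have hr' : ∀ v, v ∈ r ↔ v ∈ X ∧ p < v := fun v => (hr.2.1 v).trans mem_above
  refine ⟨?_, fun v => ?_, ?_⟩
  · refine List.Nodup.append (List.Nodup.append (List.Nodup.append hl.1 (by simp) ?_) hm.1 ?_)
      hr.1 ?_
    · intro v hv hv'
      simp only [List.mem_singleton] at hv'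
      exact ((hl' v).1 hv).2.ne hv'
    · intro v hv hv'
      have := (hm' v).1 hv'
      rcases List.mem_append.1 hv with hv | hv
      · exact this.2.1 ((hl' v).1 hv).2.le
      · exact this.2.1 (List.mem_singleton.1 hv).le
    · intro v hv hv'
      have := (hr' v).1 hv'
      rcases List.mem_append.1 hv with hv | hv
      · rcases List.mem_append.1 hv with hv | hv
        · exact this.2.asymm ((hl' v).1 hv).2
        · exact this.2.ne' (List.mem_singleton.1 hv)
      · exact ((hm' v).1 hv).2.2 this.2.le
  · simp only [List.mem_append, List.mem_singleton, hl', hm', hr']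
    constructor
    · rintro (((h | rfl) | h) | h)
      exacts [h.1, hp, h.1, h.1]
    · intro hv
      by_cases h1 : v = p
      · exact Or.inl (Or.inl (Or.inr h1))
      by_cases h2 : v ≤ p
      · exact Or.inl (Or.inl (Or.inl ⟨hv, lt_of_le_of_ne h2 h1⟩))
      by_cases h3 : p ≤ v
      · exact Or.inr ⟨hv, lt_of_le_of_ne h3 (Ne.symm h1)⟩
      · exact Or.inl (Or.inr ⟨hv, h2, h3⟩)
  · refine List.pairwise_append.2 ⟨List.pairwise_append.2 ⟨List.pairwise_append.2
      ⟨hl.2.2, by simp, ?_⟩, hm.2.2, ?_⟩, hr.2.2, ?_⟩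
    · intro a ha b hb
      rw [List.mem_singleton.1 hb]
      exact ((hl' a).1 ha).2.asymm
    · intro a ha b hb hba
      have := (hm' b).1 hb
      rcases List.mem_append.1 ha with ha | ha
      · exact this.2.1 (hba.trans ((hl' a).1 ha).2).le
      · exact this.2.1 (List.mem_singleton.1 ha ▸ hba).le
    · intro a ha b hb hba
      have := (hr' b).1 hb
      rcases List.mem_append.1 ha with ha | ha
      · rcases List.mem_append.1 ha with ha | ha
        · exact (this.2.trans hba).asymm ((hl' a).1 ha).2
        · exact this.2.asymm (List.mem_singleton.1 ha ▸ hba)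
      · exact ((hm' a).1 ha).2.2 (this.2.trans hba).le

end Convex

/-! ### The ideal recursion tree -/

section Trees

variable {V : Type u} [PartialOrder V]

theorem below_ssubset {X : Finset V} {p : V} (hp : p ∈ X) : below X p ⊂ X :=
  (below_subset X p).ssubset_of_mem_notMem hp fun h => (mem_below.1 h).2.false

theorem above_ssubset {X : Finset V} {p : V} (hp : p ∈ X) : above X p ⊂ X :=
  (above_subset X p).ssubset_of_mem_notMem hp fun h => (mem_above.1 h).2.false

theorem beside_ssubset {X : Finset V} {p : V} (hp : p ∈ X) : beside X p ⊂ X :=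
  (beside_subset X p).ssubset_of_mem_notMem hp fun h => (mem_beside.1 h).2.1 le_rfl

open Classical in
/-- The law of the recursion tree of Part-to-LE when all partitions are correct: the list of
the sets of vertices on which the procedure is called, each with its pivot. -/
def treeLaw (X : Finset V) : PMF (List (Σ X : Finset V, X)) :=
  if h : X.Nonempty then
    haveI : Nonempty X := h.to_subtype
    (PMF.uniformOfFintype X).bind fun p =>
      (treeLaw (below X p.1)).bind fun l =>
        (treeLaw (beside X p.1)).bind fun m =>
          (treeLaw (above X p.1)).map fun r => ⟨X, p⟩ :: (l ++ m ++ r)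
  else PMF.pure []
termination_by X.card
decreasing_by
  · exact Finset.card_lt_card (below_ssubset p.2)
  · exact Finset.card_lt_card (beside_ssubset p.2)
  · exact Finset.card_lt_card (above_ssubset p.2)

theorem ev_treeLaw_empty (Φ : List (Σ X : Finset V, X) → ℝ≥0∞) :
    ev (treeLaw ∅) Φ = Φ [] := by
  rw [treeLaw, dif_neg (by simp), ev_pure]

theorem ev_treeLaw {X : Finset V} (hX : X.Nonempty) (Φ : List (Σ X : Finset V, X) → ℝ≥0∞) :
    ev (treeLaw X) Φ = (X.card : ℝ≥0∞)⁻¹ * ∑ p : X,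
      ev (treeLaw (below X p)) fun l => ev (treeLaw (beside X p)) fun m =>
        ev (treeLaw (above X p)) fun r => Φ (⟨X, p⟩ :: (l ++ m ++ r)) := by
  have : Nonempty X := hX.to_subtype
  rw [treeLaw, dif_pos hX, ev_bind, ev_uniform, Fintype.card_coe]
  simp only [ev_bind, ev_map]

/-- The sum over a recursion tree of the weights of its nodes. -/
def total {M : Type*} [AddCommMonoid M] (w : ∀ X : Finset V, X → M)
    (l : List (Σ X : Finset V, X)) : M :=
  (l.map fun y => w y.1 y.2).sum

section Total

variable {M : Type*} [AddCommMonoid M] (w : ∀ X : Finset V, X → M)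

omit [PartialOrder V] in
theorem total_nil : total w [] = 0 := rfl

omit [PartialOrder V] in
theorem total_cons (y : Σ X : Finset V, X) (l : List (Σ X : Finset V, X)) :
    total w (y :: l) = w y.1 y.2 + total w l := by
  simp [total]

omit [PartialOrder V] in
theorem total_node (X : Finset V) (p : X) (l m r : List (Σ X : Finset V, X)) :
    total w (⟨X, p⟩ :: (l ++ m ++ r)) = w X p + (total w l + total w m + total w r) := by
  simp [total, add_assoc]

end Total

/-- The expected total weight of the recursion tree on `X`. -/
def meanTotal (w : ∀ X : Finset V, X → ℝ≥0∞) (X : Finset V) : ℝ≥0∞ :=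
  ev (treeLaw X) (total w)

theorem meanTotal_empty (w : ∀ X : Finset V, X → ℝ≥0∞) : meanTotal w ∅ = 0 := by
  rw [meanTotal, ev_treeLaw_empty, total_nil]

theorem meanTotal_eq (w : ∀ X : Finset V, X → ℝ≥0∞) {X : Finset V} (hX : X.Nonempty) :
    meanTotal w X = (X.card : ℝ≥0∞)⁻¹ * ∑ p : X, (w X p +
      (meanTotal w (below X p) + meanTotal w (beside X p) + meanTotal w (above X p))) := by
  rw [meanTotal, ev_treeLaw hX]
  simp only [total_node, ev_add, ev_const, meanTotal]

theorem meanTotal_mono {w w' : ∀ X : Finset V, X → ℝ≥0∞} (h : ∀ X p, w X p ≤ w' X p)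
    (X : Finset V) : meanTotal w X ≤ meanTotal w' X := by
  refine ev_mono fun l => ?_
  induction l with
  | nil => exact le_rfl
  | cons y l ih => rw [total_cons, total_cons]; exact add_le_add (h _ _) ih

/-- The exchange is legitimate because `treeLaw` does not involve the random parameter. It is what
makes a per-node hypothesis on the joint law of graph and coins sufficient. -/
theorem ev_meanTotal {α : Type*} (μ : PMF α) (w : α → ∀ X : Finset V, X → ℝ≥0∞)
    (X : Finset V) :
    ev μ (fun G => meanTotal (w G) X) = meanTotal (fun X p => ev μ fun G => w G X p) X := by
  induction X using Finset.strongInduction with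
  | H X ih =>
  rcases X.eq_empty_or_nonempty with rfl | hX
  · simp only [meanTotal_empty, ev_const]
  · simp only [meanTotal_eq _ hX, ev_const_mul, ev_finset_sum, ev_add]
    congr 1
    refine Finset.sum_congr rfl fun p _ => ?_
    rw [ih _ (below_ssubset p.2), ih _ (beside_ssubset p.2), ih _ (above_ssubset p.2)]

theorem card_split {X : Finset V} {p : V} (hp : p ∈ X) :
    1 + ((below X p).card + (beside X p).card + (above X p).card) = X.card := by
  classical
  have h : X = insert p (below X p ∪ beside X p ∪ above X p) := by
    ext v
    simp only [Finset.mem_insert, Finset.mem_union, mem_below, mem_beside, mem_above]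
    constructor
    · intro hv
      by_cases h1 : v = p
      · exact Or.inl h1
      by_cases h2 : v ≤ p
      · exact Or.inr (Or.inl (Or.inl ⟨hv, lt_of_le_of_ne h2 h1⟩))
      by_cases h3 : p ≤ v
      · exact Or.inr (Or.inr ⟨hv, lt_of_le_of_ne h3 (Ne.symm h1)⟩)
      · exact Or.inr (Or.inl (Or.inr ⟨hv, h2, h3⟩))
    · rintro (rfl | (h | h) | h)
      exacts [hp, h.1, h.1, h.1]
  conv_rhs => rw [h]
  rw [Finset.card_insert_of_notMem, Finset.card_union_of_disjoint,
    Finset.card_union_of_disjoint, add_comm]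
  · rw [Finset.disjoint_left]
    intro v hv hv'
    exact (mem_beside.1 hv').2.1 (mem_below.1 hv).2.le
  · rw [Finset.disjoint_left]
    intro v hv hv'
    have h1 := (mem_above.1 hv').2
    rcases Finset.mem_union.1 hv with hv | hv
    · exact h1.asymm (mem_below.1 hv).2
    · exact (mem_beside.1 hv).2.2 h1.le
  · simp [mem_below, mem_beside, mem_above]

/-- The recursion tree on `X` has `|X|` nodes. -/
theorem meanTotal_const (a : ℝ≥0∞) (X : Finset V) :
    meanTotal (fun _ _ => a) X = X.card * a := by
  induction X using Finset.strongInduction with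
  | H X ih =>
  rcases X.eq_empty_or_nonempty with rfl | hX
  · simp [meanTotal_empty]
  · rw [meanTotal_eq _ hX]
    have : ∀ p : X, (a + (meanTotal (fun _ _ => a) (below X p) +
        meanTotal (fun _ _ => a) (beside X p) + meanTotal (fun _ _ => a) (above X p))) =
        X.card * a := by
      intro p
      rw [ih _ (below_ssubset p.2), ih _ (beside_ssubset p.2), ih _ (above_ssubset p.2),
        ← card_split p.2]
      push_cast
      ring
    have h0 : (X.card : ℝ≥0∞) ≠ 0 := by simpa using hX.ne_empty
    rw [Finset.sum_congr rfl fun p _ => this p, Finset.sum_const, Finset.card_univ,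
      Fintype.card_coe, nsmul_eq_mul, ← mul_assoc, ENNReal.inv_mul_cancel h0 (by simp), one_mul]

end Trees

/-! ### Exponential moments of pivot counters -/

section Counters

/-- By asymmetry the predecessors of `p`, its successors and `p` itself are disjoint in `S`; summed
over `p`, predecessors and successors count the same pairs. -/
theorem two_mul_sum_card_filter_le {α : Type*} (S : Finset α) (r : α → α → Prop)
    [DecidableRel r] (hr : ∀ a ∈ S, ∀ b ∈ S, r a b → ¬ r b a) :
    2 * ∑ p ∈ S, (S.filter fun q => r q p).card + S.card ≤ S.card * S.card := by
  classical
  have hswap : ∑ p ∈ S, (S.filter fun q => r q p).card =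
      ∑ p ∈ S, (S.filter fun q => r p q).card :=
    (Finset.sum_card_bipartiteAbove_eq_sum_card_bipartiteBelow (s := S) (t := S) r).symm
  have hp : ∀ p ∈ S, (S.filter fun q => r q p).card + (S.filter fun q => r p q).card + 1 ≤
      S.card := by
    intro p hp
    rw [← Finset.card_union_of_disjoint, Nat.add_one_le_iff]
    · have hn : p ∉ (S.filter fun q => r q p) ∪ S.filter fun q => r p q := fun h => by
        simp only [Finset.mem_union, Finset.mem_filter, or_self] at h
        exact hr p hp p hp h.2 h.2
      exact Finset.card_lt_card ((Finset.union_subset (Finset.filter_subset _ _)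
        (Finset.filter_subset _ _)).ssubset_of_mem_notMem hp hn)
    · rw [Finset.disjoint_left]
      intro q hq hq'
      rw [Finset.mem_filter] at hq hq'
      exact hr q hq.1 p hp hq.2 hq'.2
  have := Finset.sum_le_sum hp
  rw [Finset.sum_add_distrib, Finset.sum_add_distrib, ← hswap] at this
  simp only [Finset.sum_const, smul_eq_mul, mul_one] at this
  omega

variable {V : Type u} [PartialOrder V]

open Classical in
/-- The number of nodes of a recursion tree whose pivot lies in the set of targets. -/
def hits (S : Finset V → Finset V) (l : List (Σ X : Finset V, X)) : ℕ :=
  total (fun X p => if p.1 ∈ S X then 1 else 0) l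

/-- `Y` is one of the three parts into which the pivot `p` splits `X`. -/
def IsPart (X : Finset V) (p : V) (Y : Finset V) : Prop :=
  Y = below X p ∨ Y = beside X p ∨ Y = above X p

/-- A family of target sets that follows the vertex `v` and shrinks, whenever the pivot is a
target, to the targets that precede the pivot in an asymmetric relation. -/
structure IsCounter (v : V) (S : Finset V → Finset V) (r : Finset V → V → V → Prop) : Prop where
  subset : ∀ X, S X ⊆ X
  eq_empty : ∀ X, v ∉ X → S X = ∅
  mono : ∀ X p Y, p ∈ X → IsPart X p Y → v ∈ Y → S Y ⊆ S X
  rel_of_mem : ∀ X p Y, p ∈ S X → IsPart X p Y → v ∈ Y → ∀ q ∈ S Y, r X q p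
  asymm : ∀ X, ∀ p ∈ S X, ∀ q ∈ S X, r X p q → ¬ r X q p

open Classical in
-- At most one of the three parts contains `v`, so two of the three factors are `1`; the remaining
-- target set shrinks as `IsCounter` prescribes.
theorem IsCounter.prod_le {v : V} {S : Finset V → Finset V} {r : Finset V → V → V → Prop}
    (h : IsCounter v S r) {X : Finset V} {p : V} (hp : p ∈ X) :
    2 ^ (if p ∈ S X then 1 else 0) *
      ((1 + (S (below X p)).card) * (1 + (S (beside X p)).card) * (1 + (S (above X p)).card)) ≤
      if p ∈ S X then 2 + 2 * ((S X).filter fun q => r X q p).card else 1 + (S X).card := by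
  have key : (1 + (S (below X p)).card) * (1 + (S (beside X p)).card) *
      (1 + (S (above X p)).card) ≤
      if p ∈ S X then 1 + ((S X).filter fun q => r X q p).card else 1 + (S X).card := by
    have hY : ∀ Y, IsPart X p Y → v ∈ Y → 1 + (S Y).card ≤
        if p ∈ S X then 1 + ((S X).filter fun q => r X q p).card else 1 + (S X).card := by
      intro Y hY hv
      split_ifs with hpS
      · refine Nat.add_le_add_left (Finset.card_le_card fun q hq => ?_) 1
        exact Finset.mem_filter.2 ⟨h.mono X p Y hp hY hv hq, h.rel_of_mem X p Y hpS hY hv q hq⟩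
      · exact Nat.add_le_add_left (Finset.card_le_card (h.mono X p Y hp hY hv)) 1
    have h1 : 1 ≤ if p ∈ S X then 1 + ((S X).filter fun q => r X q p).card
        else 1 + (S X).card := by split_ifs <;> omega
    by_cases hb : v ∈ below X p
    · rw [h.eq_empty (beside X p), h.eq_empty (above X p)]
      · simpa using hY _ (Or.inl rfl) hb
      · exact fun h' => (mem_below.1 hb).2.asymm (mem_above.1 h').2
      · exact fun h' => (mem_beside.1 h').2.1 (mem_below.1 hb).2.le
    rw [h.eq_empty _ hb]
    by_cases hm : v ∈ beside X p
    · rw [h.eq_empty (above X p)]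
      · simpa using hY _ (Or.inr (Or.inl rfl)) hm
      · exact fun h' => (mem_beside.1 hm).2.2 (mem_above.1 h').2.le
    rw [h.eq_empty _ hm]
    by_cases ha : v ∈ above X p
    · simpa using hY _ (Or.inr (Or.inr rfl)) ha
    · rw [h.eq_empty _ ha]
      simpa using h1
  split_ifs at key ⊢ with hpS
  · rw [pow_one]; omega
  · simpa using key

/-- Given the pivot, the three subtrees are independent, so the exponential moment factorizes and
the induction hypothesis applies to each factor. The gain from halving the targets pays for the
factor `2` of a hit. -/
theorem IsCounter.ev_two_pow_hits_le {v : V} {S : Finset V → Finset V}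
    {r : Finset V → V → V → Prop} (h : IsCounter v S r) (X : Finset V) :
    ev (treeLaw X) (fun l => 2 ^ hits S l) ≤ 1 + (S X).card := by
  classical
  induction X using Finset.strongInduction with
  | H X ih =>
  rcases X.eq_empty_or_nonempty with rfl | hX
  · rw [ev_treeLaw_empty, hits, total_nil]
    simp
  have hterm : ∀ p : X, (ev (treeLaw (below X p)) fun l => ev (treeLaw (beside X p)) fun m =>
      ev (treeLaw (above X p)) fun r => (2 : ℝ≥0∞) ^ hits S (⟨X, p⟩ :: (l ++ m ++ r))) ≤
      ((if p.1 ∈ S X then 2 + 2 * ((S X).filter fun q => r X q p).card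
        else 1 + (S X).card : ℕ) : ℝ≥0∞) := by
    intro p
    have hfac : (ev (treeLaw (below X p)) fun l => ev (treeLaw (beside X p)) fun m =>
        ev (treeLaw (above X p)) fun r => (2 : ℝ≥0∞) ^ hits S (⟨X, p⟩ :: (l ++ m ++ r))) =
        2 ^ (if p.1 ∈ S X then 1 else 0) *
        (ev (treeLaw (below X p)) (fun l => 2 ^ hits S l) *
         ev (treeLaw (beside X p)) (fun l => 2 ^ hits S l) *
         ev (treeLaw (above X p)) (fun l => 2 ^ hits S l)) := by
      have h2 : ∀ l m r : List (Σ X : Finset V, X),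
          (2 : ℝ≥0∞) ^ hits S (⟨X, p⟩ :: (l ++ m ++ r)) =
          2 ^ (if p.1 ∈ S X then 1 else 0) * 2 ^ hits S l * 2 ^ hits S m * 2 ^ hits S r := by
        intro l m r
        rw [hits, total_node, pow_add, pow_add, pow_add]
        simp only [hits, mul_assoc]
      simp only [h2, ev_const_mul, ev_mul_const]
      ring
    rw [hfac]
    refine le_trans ?_ (Nat.cast_le.2 (h.prod_le p.2))
    push_cast
    gcongr
    · exact ih _ (below_ssubset p.2)
    · exact ih _ (beside_ssubset p.2)
    · exact ih _ (above_ssubset p.2)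
  -- With `s` targets, target pivots contribute at most `2s + s(s-1) = s(1+s)` and the others
  -- `(|X|-s)(1+s)`, which add up to exactly `|X|(1+s)`.
  have hsum : ∑ p : X, (if p.1 ∈ S X then 2 + 2 * ((S X).filter fun q => r X q p).card
      else 1 + (S X).card) ≤ X.card * (1 + (S X).card) := by
    rw [Finset.sum_coe_sort X fun p => if p ∈ S X then
      2 + 2 * ((S X).filter fun q => r X q p).card else 1 + (S X).card,
      Finset.sum_ite, Finset.sum_const, Finset.filter_mem_eq_inter,
      Finset.inter_eq_right.2 (h.subset X), Finset.sum_add_distrib, ← Finset.mul_sum,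
      Finset.filter_notMem_eq_sdiff, smul_eq_mul, Finset.sum_const, smul_eq_mul,
      Finset.card_sdiff_of_subset (h.subset X)]
    have h1 := two_mul_sum_card_filter_le (S X) (r X) (h.asymm X)
    obtain ⟨d, hd⟩ := Nat.exists_eq_add_of_le (Finset.card_le_card (h.subset X))
    rw [hd, Nat.add_sub_cancel_left]
    nlinarith
  rw [ev_treeLaw hX]
  have h0 : (X.card : ℝ≥0∞) ≠ 0 := by simpa using hX.ne_empty
  calc _ ≤ (X.card : ℝ≥0∞)⁻¹ * ((X.card * (1 + (S X).card) : ℕ) : ℝ≥0∞) := by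
        gcongr
        refine (Finset.sum_le_sum fun p _ => hterm p).trans ?_
        rw [← Nat.cast_sum]
        exact Nat.cast_le.2 hsum
    _ = 1 + (S X).card := by
        push_cast
        rw [← mul_assoc, ENNReal.inv_mul_cancel h0 (by simp), one_mul]

end Counters

/-! ### Charging the partition cost to counters -/

section Cost

variable {V : Type u} [PartialOrder V]

/-- The strict order (`true`) or its reverse (`false`). -/
def StrictRel : Bool → V → V → Prop
  | true, a, b => a < b
  | false, a, b => b < a

theorem StrictRel.trans {s : Bool} {a b c : V} (h : StrictRel s a b) (h' : StrictRel s b c) :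
    StrictRel s a c := by
  cases s
  · exact lt_trans h' h
  · exact lt_trans h h'

theorem StrictRel.irrefl {s : Bool} {a : V} : ¬ StrictRel s a a := by
  cases s <;> exact lt_irrefl a

theorem StrictRel.comparable {s : Bool} {a b : V} (h : StrictRel s a b) : a ≤ b ∨ b ≤ a := by
  cases s
  · exact Or.inr (le_of_lt h)
  · exact Or.inl (le_of_lt h)

theorem le_or_le_iff {a b : V} :
    a ≤ b ∨ b ≤ a ↔ b = a ∨ StrictRel true a b ∨ StrictRel false a b := by
  simp only [StrictRel, le_iff_eq_or_lt]
  grind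

open Classical in
/-- The elements of `X` that are equal to `v` or lie on a given side of `v`. -/
def comparableTargets (v : V) (s : Bool) (X : Finset V) : Finset V :=
  X.filter fun q => v ∈ X ∧ (q = v ∨ StrictRel s v q)

open Classical in
/-- The elements of `X` that are incomparable to `v` and lie on a given side of some element
of `X` of colour `j`. -/
def chainTargets (χ : V → ℕ) (v : V) (s : Bool) (j : ℕ) (X : Finset V) : Finset V :=
  X.filter fun q => v ∈ X ∧ ¬ v ≤ q ∧ ¬ q ≤ v ∧ ∃ c ∈ X, χ c = j ∧ StrictRel s c q

theorem mem_comparableTargets {v q : V} {s : Bool} {X : Finset V} :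
    q ∈ comparableTargets v s X ↔ q ∈ X ∧ v ∈ X ∧ (q = v ∨ StrictRel s v q) := by
  simp [comparableTargets]

theorem mem_chainTargets {χ : V → ℕ} {v q : V} {s : Bool} {j : ℕ} {X : Finset V} :
    q ∈ chainTargets χ v s j X ↔
      q ∈ X ∧ v ∈ X ∧ ¬ v ≤ q ∧ ¬ q ≤ v ∧ ∃ c ∈ X, χ c = j ∧ StrictRel s c q := by
  simp [chainTargets]

theorem IsPart.subset {X Y : Finset V} {p : V} (h : IsPart X p Y) : Y ⊆ X := by
  rcases h with rfl | rfl | rfl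
  exacts [below_subset X p, beside_subset X p, above_subset X p]

theorem IsPart.not_mem {X Y : Finset V} {p : V} (h : IsPart X p Y) : p ∉ Y := by
  rcases h with rfl | rfl | rfl <;> simp [mem_below, mem_above, mem_beside]

theorem IsPart.strictRel {X Y : Finset V} {p v q : V} {s : Bool} (h : IsPart X p Y)
    (hv : v ∈ Y) (hq : q ∈ Y) (hvp : StrictRel s v p) : StrictRel s q p := by
  rcases h with rfl | rfl | rfl
  · rw [mem_below] at hv hq
    cases s
    · exact absurd hvp hv.2.asymm
    · exact hq.2
  · rw [mem_beside] at hv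
    rcases hvp.comparable with h | h
    · exact absurd h hv.2.1
    · exact absurd h hv.2.2
  · rw [mem_above] at hv hq
    cases s
    · exact hq.2
    · exact absurd hvp hv.2.asymm

theorem IsPart.incomparable {X Y : Finset V} {p v c : V} (h : IsPart X p Y)
    (hv : v ∈ Y) (hvp : ¬ v ≤ p) (hpv : ¬ p ≤ v) (hc : c ∈ Y) : ¬ c ≤ p ∧ ¬ p ≤ c := by
  rcases h with rfl | rfl | rfl
  · exact absurd (mem_below.1 hv).2.le hvp
  · exact (mem_beside.1 hc).2
  · exact absurd (mem_above.1 hv).2.le hpv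

/-- A pivot on the given side of `v` puts `v` in a part lying entirely on the other side of that
pivot. The pivot `v` itself ends the branch. -/
theorem isCounter_comparableTargets (v : V) (s : Bool) :
    IsCounter v (comparableTargets v s) (fun _ q p => StrictRel s q p) where
  subset X q hq := (mem_comparableTargets.1 hq).1
  eq_empty X hv := Finset.eq_empty_of_forall_notMem fun q hq => hv (mem_comparableTargets.1 hq).2.1
  mono X p Y _ hY _ q hq := by
    rw [mem_comparableTargets] at hq ⊢
    exact ⟨hY.subset hq.1, hY.subset hq.2.1, hq.2.2⟩
  rel_of_mem X p Y hp hY hv q hq := by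
    rw [mem_comparableTargets] at hp hq
    rcases hp.2.2 with rfl | hvp
    · exact absurd hv hY.not_mem
    · exact hY.strictRel hv hq.1 hvp
  asymm X p _ q _ h h' := StrictRel.irrefl (h.trans h')

/-- If the pivot `p` is incomparable to `v`, the part of `v` consists of elements incomparable to
`p`. A surviving target has in that part a witness `c` of colour `j`, which is therefore not a
witness for `p`. Asymmetry holds because colour `j` is a chain: the sets of witnesses of two targets
are nested. -/
theorem isCounter_chainTargets {χ : V → ℕ} (hχ : ∀ a b, χ a = χ b → a ≤ b ∨ b ≤ a)
    (v : V) (s : Bool) (j : ℕ) :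
    IsCounter v (chainTargets χ v s j)
      (fun X q p => ∃ c ∈ X, χ c = j ∧ StrictRel s c q ∧ ¬ StrictRel s c p) where
  subset X q hq := (mem_chainTargets.1 hq).1
  eq_empty X hv := Finset.eq_empty_of_forall_notMem fun q hq => hv (mem_chainTargets.1 hq).2.1
  mono X p Y _ hY _ q hq := by
    rw [mem_chainTargets] at hq ⊢
    obtain ⟨h1, h2, h3, h4, c, hc, h5⟩ := hq
    exact ⟨hY.subset h1, hY.subset h2, h3, h4, c, hY.subset hc, h5⟩
  rel_of_mem X p Y hp hY hv q hq := by
    rw [mem_chainTargets] at hp hq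
    obtain ⟨-, -, -, -, c, hc, hcj, hcq⟩ := hq
    refine ⟨c, hY.subset hc, hcj, hcq, fun hcp => ?_⟩
    have := hY.incomparable hv hp.2.2.1 hp.2.2.2.1 hc
    exact hcp.comparable.elim this.1 this.2
  asymm := by
    rintro X p - q - ⟨c, -, hcj, hcp, hcq⟩ ⟨d, -, hdj, hdq, hdp⟩
    rcases le_or_le_iff.1 (hχ c d (hcj.trans hdj.symm)) with rfl | h | h
    · exact hcq hdq
    · cases s
      · exact hdp (StrictRel.trans (s := false) h hcp)
      · exact hcq (StrictRel.trans (s := true) h hdq)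
    · cases s
      · exact hcq (StrictRel.trans (s := false) h hdq)
      · exact hdp (StrictRel.trans (s := true) h hcp)

/-- The cost of a partition step, without the factors that do not depend on the step. -/
def stepCost (X : Finset V) (p : X) : ℕ :=
  X.card * (width (below X p) + width (above X p))

open Classical in
-- Every colour class is a chain, so an antichain below `p` has at most one element of each colour
-- occurring there.
theorem width_below_le {χ : V → ℕ} {k : ℕ} (hχ : ∀ a b, χ a = χ b → a ≤ b ∨ b ≤ a)
    (hk : ∀ a, χ a < k) (X : Finset V) (p : V) :
    width (below X p) ≤ ∑ j ∈ Finset.range k,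
      if ∃ c ∈ X, χ c = j ∧ StrictRel true c p then 1 else 0 := by
  rw [← Finset.card_filter]
  refine width_le_card_of_coloring (χ := χ) (fun u _ v _ => hχ u v) fun v hv => ?_
  rw [Finset.mem_filter, Finset.mem_range]
  exact ⟨hk v, v, (mem_below.1 hv).1, rfl, (mem_below.1 hv).2⟩

open Classical in
theorem width_above_le {χ : V → ℕ} {k : ℕ} (hχ : ∀ a b, χ a = χ b → a ≤ b ∨ b ≤ a)
    (hk : ∀ a, χ a < k) (X : Finset V) (p : V) :
    width (above X p) ≤ ∑ j ∈ Finset.range k,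
      if ∃ c ∈ X, χ c = j ∧ StrictRel false c p then 1 else 0 := by
  rw [← Finset.card_filter]
  refine width_le_card_of_coloring (χ := χ) (fun u _ v _ => hχ u v) fun v hv => ?_
  rw [Finset.mem_filter, Finset.mem_range]
  exact ⟨hk v, v, (mem_above.1 hv).1, rfl, (mem_above.1 hv).2⟩

open Classical in
-- The factor `|X|` is read as a sum over `v ∈ X`. For `v` comparable to the pivot the crude bound
-- `2k` on the two widths suffices; for `v` incomparable to it the chain targets reproduce the
-- bounds on the widths.
theorem stepCost_le [Fintype V] {χ : V → ℕ} {k : ℕ}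
    (hχ : ∀ a b, χ a = χ b → a ≤ b ∨ b ≤ a) (hk : ∀ a, χ a < k) (X : Finset V) (p : X) :
    stepCost X p ≤ ∑ v : V, ∑ s : Bool,
      (2 * k * (if p.1 ∈ comparableTargets v s X then 1 else 0) +
        ∑ j ∈ Finset.range k, if p.1 ∈ chainTargets χ v s j X then 1 else 0) := by
  have hb := width_below_le hχ hk X p
  have ha := width_above_le hχ hk X p
  have hk1 : ∀ t : Bool, (∑ j ∈ Finset.range k,
      if ∃ c ∈ X, χ c = j ∧ StrictRel t c p.1 then 1 else 0) ≤ k := by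
    intro t
    rw [← Finset.card_filter]
    exact (Finset.card_filter_le _ _).trans (Finset.card_range k).le
  have hv : ∀ v ∈ X, width (below X p) + width (above X p) ≤ ∑ s : Bool,
      (2 * k * (if p.1 ∈ comparableTargets v s X then 1 else 0) +
        ∑ j ∈ Finset.range k, if p.1 ∈ chainTargets χ v s j X then 1 else 0) := by
    intro v hv
    rw [Fintype.sum_bool]
    by_cases hcomp : v ≤ p.1 ∨ p.1 ≤ v
    · have h2 := (hb.trans (hk1 true))
      have h3 := (ha.trans (hk1 false))
      have : p.1 ∈ comparableTargets v true X ∨ p.1 ∈ comparableTargets v false X := by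
        simp only [mem_comparableTargets]
        rcases le_or_le_iff.1 hcomp with h | h | h
        · exact Or.inl ⟨p.2, hv, Or.inl h⟩
        · exact Or.inl ⟨p.2, hv, Or.inr h⟩
        · exact Or.inr ⟨p.2, hv, Or.inr h⟩
      rcases this with h | h
      · rw [if_pos h]; omega
      · rw [if_pos h]; omega
    · rw [not_or] at hcomp
      have h : ∀ (s : Bool) (j : ℕ), p.1 ∈ chainTargets χ v s j X ↔
          ∃ c ∈ X, χ c = j ∧ StrictRel s c p.1 := fun s j => by
        rw [mem_chainTargets]
        exact ⟨fun h => h.2.2.2.2, fun h => ⟨p.2, hv, hcomp.1, hcomp.2, h⟩⟩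
      simp only [h]
      omega
  calc stepCost X p = ∑ v ∈ X, (width (below X p) + width (above X p)) := by
        rw [Finset.sum_const, smul_eq_mul, stepCost]
    _ ≤ _ := Finset.sum_le_sum hv
    _ ≤ _ := Finset.sum_le_sum_of_subset (Finset.subset_univ X)

/-- An exponential functional of the recursion tree that controls its cost. -/
def costPotential [Fintype V] (χ : V → ℕ) (k : ℕ) (l : List (Σ X : Finset V, X)) : ℕ :=
  ∑ v : V, ∑ s : Bool, (2 ^ hits (comparableTargets v s) l +
    ∑ j ∈ Finset.range k, 2 ^ hits (chainTargets χ v s j) l)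

theorem total_stepCost_le [Fintype V] {χ : V → ℕ} {k : ℕ}
    (hχ : ∀ a b, χ a = χ b → a ≤ b ∨ b ≤ a) (hk : ∀ a, χ a < k)
    (l : List (Σ X : Finset V, X)) :
    total stepCost l ≤ ∑ v : V, ∑ s : Bool, (2 * k * hits (comparableTargets v s) l +
        ∑ j ∈ Finset.range k, hits (chainTargets χ v s j) l) := by
  induction l with
  | nil => simp [total_nil]
  | cons y l ih =>
    rw [total_cons]
    refine (add_le_add (stepCost_le hχ hk y.1 y.2) ih).trans (le_of_eq ?_)
    simp only [hits, total_cons, ← Finset.sum_add_distrib]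
    refine Finset.sum_congr rfl fun v _ => Finset.sum_congr rfl fun s _ => ?_
    rw [Finset.sum_add_distrib]
    ring

/-- This is `N ≤ r + 2 ^ (N - r)` cleared of denominators: it passes from a count to its exponential
at the cost of an additive `r`. -/
theorem two_pow_mul_le (r N : ℕ) : 2 ^ r * N ≤ 2 ^ r * r + 2 ^ N := by
  rcases le_total N r with h | h
  · exact (Nat.mul_le_mul_left (2 ^ r) h).trans (Nat.le_add_right _ _)
  · obtain ⟨d, rfl⟩ := Nat.exists_eq_add_of_le h
    rw [pow_add, mul_add]
    have := Nat.mul_le_mul_left (2 ^ r) (Nat.lt_two_pow_self (n := d)).le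
    omega

theorem two_pow_mul_total_le [Fintype V] {χ : V → ℕ} {k : ℕ}
    (hχ : ∀ a b, χ a = χ b → a ≤ b ∨ b ≤ a) (hk : ∀ a, χ a < k)
    (l : List (Σ X : Finset V, X)) (r : ℕ) :
    2 ^ r * total stepCost l ≤
      2 ^ r * (6 * Fintype.card V * k * r) + 2 * k * costPotential χ k l := by
  refine (Nat.mul_le_mul_left _ (total_stepCost_le hχ hk l)).trans ?_
  have hterm : ∀ (v : V) (s : Bool), 2 ^ r * (2 * k * hits (comparableTargets v s) l +
        ∑ j ∈ Finset.range k, hits (chainTargets χ v s j) l) ≤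
      2 ^ r * (3 * k * r) + 2 * k * (2 ^ hits (comparableTargets v s) l +
        ∑ j ∈ Finset.range k, 2 ^ hits (chainTargets χ v s j) l) := by
    intro v s
    have h1 := Nat.mul_le_mul_left (2 * k) (two_pow_mul_le r (hits (comparableTargets v s) l))
    have h2 : 2 ^ r * ∑ j ∈ Finset.range k, hits (chainTargets χ v s j) l ≤
        k * (2 ^ r * r) + ∑ j ∈ Finset.range k, 2 ^ hits (chainTargets χ v s j) l := by
      rw [Finset.mul_sum]
      refine (Finset.sum_le_sum fun j _ => two_pow_mul_le r _).trans ?_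
      rw [Finset.sum_add_distrib, Finset.sum_const, Finset.card_range, smul_eq_mul]
    -- A deliberate loss, so that both kinds of counters carry the weight `2k` in `costPotential`.
    have h3 : ∑ j ∈ Finset.range k, 2 ^ hits (chainTargets χ v s j) l ≤
        2 * k * ∑ j ∈ Finset.range k, 2 ^ hits (chainTargets χ v s j) l := by
      rcases Nat.eq_zero_or_pos k with rfl | h
      · simp
      · exact Nat.le_mul_of_pos_left _ (by omega)
    nlinarith
  simp only [costPotential, Finset.mul_sum]
  calc _ ≤ ∑ v : V, ∑ s : Bool, (2 ^ r * (3 * k * r) +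
        2 * k * (2 ^ hits (comparableTargets v s) l +
        ∑ j ∈ Finset.range k, 2 ^ hits (chainTargets χ v s j) l)) :=
      Finset.sum_le_sum fun v _ => Finset.sum_le_sum fun s _ => hterm v s
    _ = _ := by
      simp only [Finset.sum_add_distrib, Finset.sum_const, Finset.card_univ, smul_eq_mul,
        Fintype.card_bool]
      ring

theorem ev_costPotential_le [Fintype V] {χ : V → ℕ} (hχ : ∀ a b, χ a = χ b → a ≤ b ∨ b ≤ a)
    (k : ℕ) :
    ev (treeLaw (Finset.univ : Finset V)) (fun l => (costPotential χ k l : ℝ≥0∞)) ≤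
      ((2 * Fintype.card V * (k + 1) * (Fintype.card V + 1) : ℕ) : ℝ≥0∞) := by
  have hcount : ∀ (v : V) (S : Finset V → Finset V) (r : Finset V → V → V → Prop),
      IsCounter v S r → ev (treeLaw (Finset.univ : Finset V)) (fun l => 2 ^ hits S l) ≤
        (Fintype.card V : ℝ≥0∞) + 1 := by
    intro v S r h
    refine (h.ev_two_pow_hits_le _).trans ?_
    rw [add_comm]
    gcongr
    exact Finset.card_le_univ _
  simp only [costPotential, Nat.cast_sum, Nat.cast_add, Nat.cast_pow, Nat.cast_ofNat,
    ev_finset_sum, ev_add]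
  calc _ ≤ ∑ v : V, ∑ s : Bool, (((Fintype.card V : ℝ≥0∞) + 1) +
        ∑ j ∈ Finset.range k, ((Fintype.card V : ℝ≥0∞) + 1)) := by
        refine Finset.sum_le_sum fun v _ => Finset.sum_le_sum fun s _ => add_le_add ?_
          (Finset.sum_le_sum fun j _ => ?_)
        · exact hcount v _ _ (isCounter_comparableTargets v s)
        · exact hcount v _ _ (isCounter_chainTargets hχ v s j)
    _ = _ := by
      simp only [Finset.sum_const, Finset.card_univ, Finset.card_range, Fintype.card_bool,
        nsmul_eq_mul]
      push_cast
      ring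

end Cost

/-! ### Comparing real runs with the ideal tree -/

section Runs

variable {V : Type u} [PartialOrder V]

/-- The law of the output and of the number of queries of the partition procedure on the
induced subgraph on `X`, for a fixed query graph. -/
def partRun (A : PartitionAlg V) (G : SimpleGraph V) (X : Finset V) (p : X) :
    PMF (Parts p × ℕ) :=
  (A X (inducedOn G X) p).run (oracle (inducedOn G X))

/-- The law of the output and of the number of queries of Part-to-LE on `X`, for a fixed query
graph. -/
def sortRun (A : PartitionAlg V) (G : SimpleGraph V) (X : Finset V) : PMF (List V × ℕ) :=
  (partToLE A G X).run (oracle G)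

theorem oracle_comp_liftDart (G : SimpleGraph V) (X : Finset V) :
    oracle G ∘ liftDart G X = oracle (inducedOn G X) := by
  funext d
  rfl

theorem ev_sortRun_empty (A : PartitionAlg V) (G : SimpleGraph V) (Φ : List V × ℕ → ℝ≥0∞) :
    ev (sortRun A G ∅) Φ = Φ ([], 0) := by
  rw [sortRun, partToLE, dif_neg (by simp), QueryAlg.run, ev_pure]

theorem ev_sortRun (A : PartitionAlg V) (G : SimpleGraph V) {X : Finset V} (hX : X.Nonempty)
    (Φ : List V × ℕ → ℝ≥0∞) :
    ev (sortRun A G X) Φ = (X.card : ℝ≥0∞)⁻¹ * ∑ p : X, ev (partRun A G X p) fun t =>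
      ev (sortRun A G (liftSet t.1.lower)) fun l =>
        ev (sortRun A G (liftSet t.1.middle)) fun m =>
          ev (sortRun A G (liftSet t.1.upper)) fun r =>
            Φ (l.1 ++ [p.1] ++ m.1 ++ r.1, t.2 + (l.2 + (m.2 + r.2))) := by
  have : Nonempty X := hX.to_subtype
  rw [sortRun, partToLE, dif_pos hX, QueryAlg.run, ev_bind, ev_uniform, Fintype.card_coe]
  simp only [QueryAlg.ev_run_bind, QueryAlg.run_mapQuery, oracle_comp_liftDart, QueryAlg.run,
    ev_pure, add_zero]
  rfl

open Classical in
/-- `F` of the number of queries if the output is a linear extension of `X`, otherwise `1`. -/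
def penalty (X : Finset V) (F : ℝ≥0∞ → ℝ≥0∞) (s : List V × ℕ) : ℝ≥0∞ :=
  if IsLinearExtensionOn X s.1 then F s.2 else 1

theorem penalty_le_one {X : Finset V} {F : ℝ≥0∞ → ℝ≥0∞} (hF : ∀ x, F x ≤ 1)
    (s : List V × ℕ) : penalty X F s ≤ 1 := by
  unfold penalty
  split_ifs
  exacts [hF _, le_rfl]

theorem ev_le_one {α : Type*} {P : PMF α} {Φ : α → ℝ≥0∞} (h : ∀ a, Φ a ≤ 1) : ev P Φ ≤ 1 :=
  (ev_mono h).trans (ev_const P 1).le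

open Classical in
/-- The probability that the partition procedure is incorrect or exceeds the bound `w` on the
number of queries. -/
def failure (A : PartitionAlg V) (w : ∀ X : Finset V, X → ℝ≥0∞) (G : SimpleGraph V)
    (X : Finset V) (p : X) : ℝ≥0∞ :=
  ev (partRun A G X p) fun t =>
    if t.1.Correct (inducedOn G X) ∧ (t.2 : ℝ≥0∞) ≤ w X p then 0 else 1

/-- Up to the expected number of failures of the partition procedure, the number of queries is
dominated by the weight of the recursion tree. -/
theorem ev_penalty_le (A : PartitionAlg V) (w : ∀ X : Finset V, X → ℝ≥0∞)
    {G : SimpleGraph V} (hG : InducesOrder G) (X : Finset V) (hX : IsConvex X)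
    (F : ℝ≥0∞ → ℝ≥0∞) (hF : Monotone F) (hF1 : ∀ x, F x ≤ 1) :
    ev (sortRun A G X) (penalty X F) ≤
      ev (treeLaw X) (fun l => F (total w l)) + meanTotal (failure A w G) X := by
  classical
  induction X using Finset.strongInduction generalizing F with
  | H X ih =>
  rcases X.eq_empty_or_nonempty with rfl | hne
  · rw [ev_sortRun_empty, ev_treeLaw_empty, penalty, if_pos isLinearExtensionOn_empty,
      total_nil, Nat.cast_zero]
    exact le_self_add
  rw [ev_sortRun A G hne, ev_treeLaw hne, meanTotal_eq _ hne, ← mul_add,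
    ← Finset.sum_add_distrib]
  gcongr with p
  set L := below X p.1
  set M := beside X p.1
  set R := above X p.1
  have ihL := ih L (below_ssubset p.2) (hX.below p)
  have ihM := ih M (beside_ssubset p.2) (hX.beside p)
  have ihR := ih R (above_ssubset p.2) (hX.above p)
  set dL := meanTotal (failure A w G) L
  set dM := meanTotal (failure A w G) M
  set dR := meanTotal (failure A w G) R
  set E := ev (treeLaw L) fun l => ev (treeLaw M) fun m => ev (treeLaw R) fun r =>
    F (total w (⟨X, p⟩ :: (l ++ m ++ r))) with hE
  -- After a good partition the three recursive runs are replaced by ideal trees one at a time, the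
  -- last one first. A wrong sublist already has penalty `1`, which dominates anything that follows.
  have hgood : ∀ t : Parts p × ℕ,
      t.1.Correct (inducedOn G X) → (t.2 : ℝ≥0∞) ≤ w X p →
      (ev (sortRun A G (liftSet t.1.lower)) fun l =>
        ev (sortRun A G (liftSet t.1.middle)) fun m =>
          ev (sortRun A G (liftSet t.1.upper)) fun r =>
            penalty X F (l.1 ++ [p.1] ++ m.1 ++ r.1, t.2 + (l.2 + (m.2 + r.2)))) ≤
      E + (dL + dM + dR) := by
    intro t hT hq
    rw [hT.lift_lower hG hX, hT.lift_middle hG hX, hT.lift_upper hG hX]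
    -- The test functions for the induction: `F` with the earlier costs frozen and the later ones
    -- averaged over ideal trees. They inherit monotonicity and the bound by `1`, which is why `F`
    -- is generalized.
    let F₁ : ℝ≥0∞ → ℝ≥0∞ → ℝ≥0∞ → ℝ≥0∞ := fun x y z => F (t.2 + (x + (y + z)))
    let F₂ : ℝ≥0∞ → ℝ≥0∞ → ℝ≥0∞ := fun x y =>
      ev (treeLaw R) fun r => F₁ x y (total w r)
    let F₃ : ℝ≥0∞ → ℝ≥0∞ := fun x => ev (treeLaw M) fun m => F₂ x (total w m)
    have hF₁ : ∀ x y, Monotone (F₁ x y) := fun x y z z' h => hF (by gcongr)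
    have hF₂ : ∀ x, Monotone (F₂ x) := fun x y y' h => ev_mono fun r => hF (by gcongr)
    have hF₃ : Monotone F₃ := fun x x' h => ev_mono fun m => ev_mono fun r => hF (by gcongr)
    have hR : ∀ l m : List V × ℕ, IsLinearExtensionOn L l.1 →
        (ev (sortRun A G R) fun r =>
          penalty X F (l.1 ++ [p.1] ++ m.1 ++ r.1, t.2 + (l.2 + (m.2 + r.2)))) ≤
          penalty M (F₂ l.2) m + dR := by
      intro l m hl
      by_cases hm : IsLinearExtensionOn M m.1
      · rw [penalty, if_pos hm]
        refine le_trans (ev_mono fun r => ?_) (ihR (F₁ l.2 m.2) (hF₁ _ _) fun _ => hF1 _)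
        by_cases hr : IsLinearExtensionOn R r.1
        · rw [penalty, penalty, if_pos hr, if_pos (hl.concat p.2 hm hr)]
          simp only [F₁]
          push_cast
          exact le_rfl
        · rw [penalty.eq_1 R, if_neg hr]
          exact penalty_le_one hF1 _
      · rw [penalty.eq_1 M, if_neg hm]
        exact (ev_le_one fun _ => penalty_le_one hF1 _).trans le_self_add
    have hM : ∀ l : List V × ℕ, (ev (sortRun A G M) fun m => ev (sortRun A G R) fun r =>
          penalty X F (l.1 ++ [p.1] ++ m.1 ++ r.1, t.2 + (l.2 + (m.2 + r.2)))) ≤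
          penalty L F₃ l + (dM + dR) := by
      intro l
      by_cases hl : IsLinearExtensionOn L l.1
      · rw [penalty.eq_1 L, if_pos hl, ← add_assoc]
        refine (ev_mono fun m => hR l m hl).trans ?_
        rw [ev_add, ev_const]
        gcongr
        exact ihM (F₂ l.2) (hF₂ _) fun _ => ev_le_one fun _ => hF1 _
      · rw [penalty.eq_1 L, if_neg hl]
        exact (ev_le_one fun _ => ev_le_one fun _ => penalty_le_one hF1 _).trans le_self_add
    refine (ev_mono hM).trans ?_
    rw [ev_add, ev_const]
    refine (add_le_add_left (ihL F₃ hF₃ fun _ => ev_le_one fun _ => ev_le_one fun _ =>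
      hF1 _) _).trans ?_
    rw [add_assoc, ← add_assoc dL]
    gcongr
    refine ev_mono fun l => ev_mono fun m => ev_mono fun r => hF ?_
    rw [total_node, add_assoc (total w l)]
    gcongr
  -- After a failed partition nothing is known about the sets in the recursive calls; the indicator
  -- pays for the trivial bound `1`.
  calc _ ≤ ev (partRun A G X p) fun t =>
        (if t.1.Correct (inducedOn G X) ∧ (t.2 : ℝ≥0∞) ≤ w X p then 0 else 1) +
          (E + (dL + dM + dR)) := by
        refine ev_mono fun t => ?_
        split_ifs with h
        · rw [zero_add]
          exact hgood t h.1 h.2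
        · exact (ev_le_one fun _ => ev_le_one fun _ => ev_le_one fun _ =>
            penalty_le_one hF1 _).trans le_self_add
    _ = _ := by
        rw [ev_add, ev_const, failure]
        ring

/-- The expected number of queries, if the partition procedure is always correct. -/
theorem ev_queries_le (A : PartitionAlg V) {G : SimpleGraph V} (hG : InducesOrder G)
    (hA : ∀ (X : Finset V) (p : X), ∀ t ∈ (partRun A G X p).support,
      t.1.Correct (inducedOn G X))
    (X : Finset V) (hX : IsConvex X) :
    ev (sortRun A G X) (fun s => (s.2 : ℝ≥0∞)) ≤
      meanTotal (fun X p => ev (partRun A G X p) fun t => (t.2 : ℝ≥0∞)) X := by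
  induction X using Finset.strongInduction with
  | H X ih =>
  rcases X.eq_empty_or_nonempty with rfl | hne
  · rw [ev_sortRun_empty, Nat.cast_zero]
    exact zero_le
  rw [ev_sortRun A G hne, meanTotal_eq _ hne]
  gcongr with p
  rw [← ev_const (partRun A G X p) (_ + _ + _), ← ev_add]
  refine ev_mono_support fun t ht => ?_
  have hT := hA X p t ht
  rw [hT.lift_lower hG hX, hT.lift_middle hG hX, hT.lift_upper hG hX]
  push_cast
  simp only [ev_add, ev_const]
  rw [add_assoc (meanTotal _ _)]
  gcongr
  · exact ih _ (below_ssubset p.2) (hX.below p)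
  · exact ih _ (beside_ssubset p.2) (hX.beside p)
  · exact ih _ (above_ssubset p.2) (hX.above p)

end Runs

/-! ### Tail and mean of the cost of the ideal tree -/

section TreeBounds

variable {V : Type u} [PartialOrder V] [Fintype V]

omit [Fintype V] in
theorem stepCost_eq_zero [Subsingleton V] (X : Finset V) (p : X) : stepCost X p = 0 := by
  have hb : below X p.1 = ∅ := Finset.eq_empty_of_forall_notMem fun v hv =>
    (mem_below.1 hv).2.ne (Subsingleton.elim _ _)
  have ha : above X p.1 = ∅ := Finset.eq_empty_of_forall_notMem fun v hv =>
    (mem_above.1 hv).2.ne (Subsingleton.elim _ _)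
  simp [stepCost, hb, ha, width_empty]

omit [Fintype V] in
theorem total_stepCost_eq_zero [Subsingleton V] (l : List (Σ X : Finset V, X)) :
    total stepCost l = 0 := by
  induction l with
  | nil => rfl
  | cons y l ih => rw [total_cons, ih, stepCost_eq_zero]

omit [PartialOrder V] [Fintype V] in
theorem pow_eleven_le_two_pow (n : ℕ) : n ^ 11 ≤ 2 ^ (11 * Nat.clog 2 n) := by
  rw [mul_comm, pow_mul]
  exact Nat.pow_le_pow_left (Nat.le_pow_clog one_lt_two n) 11

/-- The mean of the potential is at most `2 n ^ 5`; the six further powers of `n` are the wanted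
error, which explains the exponent `11`. -/
theorem costPotential_bound {n k : ℕ} (hn : 2 ≤ n) (hk : k ≤ n) :
    2 * n * (k + 1) * (n + 1) * n ^ 6 ≤ 2 * 2 ^ (11 * Nat.clog 2 n) := by
  have h1 : n + 1 ≤ n ^ 2 := by nlinarith
  calc 2 * n * (k + 1) * (n + 1) * n ^ 6 ≤ 2 * n * (n ^ 2) * (n ^ 2) * n ^ 6 := by
        gcongr
        omega
    _ = 2 * n ^ 11 := by ring
    _ ≤ _ := Nat.mul_le_mul_left 2 (pow_eleven_le_two_pow n)

/-- The left side has order `n k log n` only; the second logarithm is slack that absorbs constants,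
as `log n ≥ 0.69`. From `2 ^ (clog - 1) < n` one gets `clog · log 2 ≤ 2 log n`. -/
theorem threshold_le {n k : ℕ} (hn : 2 ≤ n) :
    ((6 * n * k * (11 * Nat.clog 2 n) + 2 * k : ℕ) : ℝ) ≤
      400 * (n * k * Real.log n ^ 2) := by
  have hlog2 : 0.69 < Real.log 2 := by linarith [Real.log_two_gt_d9]
  have hn' : (2 : ℝ) ≤ n := by exact_mod_cast hn
  have hlog : Real.log 2 ≤ Real.log n := Real.log_le_log two_pos hn'
  have hclog : (Nat.clog 2 n : ℝ) * 0.69 ≤ 2 * Real.log n := by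
    have h1 : 2 ^ (Nat.clog 2 n - 1) < n := Nat.pow_pred_clog_lt_self one_lt_two hn
    have h2 : 1 ≤ Nat.clog 2 n := Nat.clog_pos one_lt_two hn
    have h3 : ((Nat.clog 2 n - 1 : ℕ) : ℝ) * Real.log 2 ≤ Real.log n := by
      rw [← Real.log_pow]
      exact Real.log_le_log (by positivity) (by exact_mod_cast h1.le)
    rw [Nat.cast_sub h2, Nat.cast_one] at h3
    have h4 : (0 : ℝ) ≤ Nat.clog 2 n := Nat.cast_nonneg _
    nlinarith
  set L := Real.log n
  set c := (Nat.clog 2 n : ℝ)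
  have hL : 0.69 ≤ L := by linarith
  have hc : 66 * c + 1 ≤ 400 * L ^ 2 := by nlinarith
  have hk : (0 : ℝ) ≤ k := Nat.cast_nonneg k
  push_cast
  have hnk : (0 : ℝ) ≤ n * k := by positivity
  have h2k : 2 * (k : ℝ) ≤ n * k := by gcongr
  nlinarith [mul_le_mul_of_nonneg_left hc hnk]

theorem ev_costPotential_le_two_pow {χ : V → ℕ} (hχ : ∀ a b, χ a = χ b → a ≤ b ∨ b ≤ a)
    {n k : ℕ} (hn : n = Fintype.card V) (h2 : 2 ≤ n) (hk : k ≤ n) :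
    (2 ^ (11 * Nat.clog 2 n) : ℝ≥0∞)⁻¹ *
      ev (treeLaw (Finset.univ : Finset V)) (fun l => (costPotential χ k l : ℝ≥0∞)) ≤
      ENNReal.ofReal (2 * (n : ℝ) ^ (-6 : ℤ)) := by
  have hn0 : (0 : ℝ) < n := by
    have : 0 < n := by omega
    exact_mod_cast this
  have h1 := ev_costPotential_le hχ k
  rw [← hn] at h1
  rw [mul_comm, ← div_eq_mul_inv]
  refine ENNReal.div_le_of_le_mul (h1.trans ?_)
  have h3 : (2 ^ (11 * Nat.clog 2 n) : ℝ≥0∞) =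
      ENNReal.ofReal ((2 ^ (11 * Nat.clog 2 n) : ℕ) : ℝ) := by
    rw [ENNReal.ofReal_natCast]
    push_cast
    rfl
  rw [h3, ← ENNReal.ofReal_mul (by positivity), ← ENNReal.ofReal_natCast]
  refine ENNReal.ofReal_le_ofReal ?_
  have h4 : ((2 * n * (k + 1) * (n + 1) * n ^ 6 : ℕ) : ℝ) ≤
      ((2 * 2 ^ (11 * Nat.clog 2 n) : ℕ) : ℝ) := Nat.cast_le.2 (costPotential_bound h2 hk)
  have h5 : (2 : ℝ) * (n : ℝ) ^ (-6 : ℤ) * ((2 ^ (11 * Nat.clog 2 n) : ℕ) : ℝ) =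
      ((2 * 2 ^ (11 * Nat.clog 2 n) : ℕ) : ℝ) / (n : ℝ) ^ 6 := by
    rw [zpow_neg]
    push_cast
    rw [show (6 : ℤ) = ((6 : ℕ) : ℤ) by rfl, zpow_natCast]
    field_simp
  rw [h5, le_div_iff₀ (by positivity)]
  exact_mod_cast h4

theorem exists_coloring_univ {k : ℕ} (hk : k = width (Finset.univ : Finset V)) :
    ∃ χ : V → ℕ, (∀ a, χ a < k) ∧ ∀ a b, χ a = χ b → a ≤ b ∨ b ≤ a := by
  obtain ⟨χ, hlt, hχ⟩ := exists_chain_coloring (Finset.univ : Finset V)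
  exact ⟨χ, fun a => hk ▸ hlt a (Finset.mem_univ a), fun a b =>
    hχ a (Finset.mem_univ a) b (Finset.mem_univ b)⟩

open Classical in
/-- The cost of the recursion tree is small with high probability. -/
theorem ev_total_stepCost_gt_le {n k : ℕ} (hn : n = Fintype.card V)
    (hk : k = width (Finset.univ : Finset V)) :
    ev (treeLaw (Finset.univ : Finset V)) (fun l =>
      if ((total stepCost l : ℕ) : ℝ) ≤ 400 * (n * k * Real.log n ^ 2) then 0 else 1) ≤
      ENNReal.ofReal (2 * (n : ℝ) ^ (-6 : ℤ)) := by
  -- For `n ≤ 1` the bound vanishes with `log n`, so the cost must be exactly zero; it is, as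
  -- nothing lies below or above the pivot.
  rcases Nat.lt_or_ge n 2 with h2 | h2
  · have : Subsingleton V := Fintype.card_le_one_iff_subsingleton.1 (by omega)
    refine le_trans (ev_mono fun l => ?_) ((ev_const _ 0).le.trans zero_le)
    rw [total_stepCost_eq_zero, Nat.cast_zero, if_pos (by positivity)]
  · obtain ⟨χ, hlt, hχ⟩ := exists_coloring_univ hk
    have hkn : k ≤ n := by rw [hk, hn]; exact width_le_card _
    refine le_trans ?_ (ev_costPotential_le_two_pow hχ hn h2 hkn)
    rw [← ev_const_mul]
    refine ev_mono fun l => ?_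
    split_ifs with h
    · exact zero_le
    · have hlt' : 6 * n * k * (11 * Nat.clog 2 n) + 2 * k < total stepCost l := by
        by_contra! hle
        exact h (le_trans (Nat.cast_le.2 hle) (threshold_le h2))
      have hb := two_pow_mul_total_le hχ hlt l (11 * Nat.clog 2 n)
      rw [← hn] at hb
      -- The summand `2k` in the threshold serves here: exceeding it forces the potential up to `2 ^
      -- r`, and Markov's inequality applies.
      have hK : 2 ^ (11 * Nat.clog 2 n) ≤ costPotential χ k l := by
        by_contra! hK
        have h1 := Nat.mul_le_mul_left (2 * k) hK.le
        have h3 := Nat.mul_lt_mul_of_pos_left hlt' (Nat.two_pow_pos (11 * Nat.clog 2 n))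
        rw [mul_add] at h3
        have h4 : 2 ^ (11 * Nat.clog 2 n) * (2 * k) = 2 * k * 2 ^ (11 * Nat.clog 2 n) :=
          mul_comm _ _
        omega
      rw [mul_comm, ← div_eq_mul_inv, ENNReal.le_div_iff_mul_le (Or.inl (by positivity))
        (Or.inl (by finiteness)), one_mul]
      exact_mod_cast hK

/-- The cost of the recursion tree is small in expectation. -/
theorem ev_total_stepCost_le {n k : ℕ} (hn : n = Fintype.card V)
    (hk : k = width (Finset.univ : Finset V)) :
    ev (treeLaw (Finset.univ : Finset V)) (fun l => ((total stepCost l : ℕ) : ℝ≥0∞)) ≤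
      ENNReal.ofReal (400 * (n * k * Real.log n ^ 2)) := by
  rcases Nat.lt_or_ge n 2 with h2 | h2
  · have : Subsingleton V := Fintype.card_le_one_iff_subsingleton.1 (by omega)
    simp only [total_stepCost_eq_zero, Nat.cast_zero, ev_const]
    exact zero_le
  · obtain ⟨χ, hlt, hχ⟩ := exists_coloring_univ hk
    have hkn : k ≤ n := by rw [hk, hn]; exact width_le_card _
    have hK := ev_costPotential_le_two_pow hχ hn h2 hkn
    set r := 11 * Nat.clog 2 n with hr
    set E := ev (treeLaw (Finset.univ : Finset V)) (fun l => (costPotential χ k l : ℝ≥0∞))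
    have hn' : (2 : ℝ) ≤ n := by exact_mod_cast h2
    have h6 : ENNReal.ofReal (2 * (n : ℝ) ^ (-6 : ℤ)) ≤ 1 := by
      rw [ENNReal.ofReal_le_one, zpow_neg, ← div_eq_mul_inv, div_le_one (by positivity)]
      calc (2 : ℝ) ≤ n := hn'
        _ = (n : ℝ) ^ (1 : ℤ) := (zpow_one _).symm
        _ ≤ (n : ℝ) ^ (6 : ℤ) := zpow_le_zpow_right₀ (by linarith) (by norm_num)
    have h0 : (2 ^ r : ℝ≥0∞) ≠ 0 := by positivity
    have htop : (2 ^ r : ℝ≥0∞) ≠ ⊤ := by finiteness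
    calc _ ≤ ev (treeLaw (Finset.univ : Finset V)) (fun l =>
          ((6 * n * k * r : ℕ) : ℝ≥0∞) +
            2 * k * ((2 ^ r : ℝ≥0∞)⁻¹ * (costPotential χ k l : ℝ≥0∞))) := by
          refine ev_mono fun l => ?_
          have hb := two_pow_mul_total_le hχ hlt l r
          rw [← hn] at hb
          have hb' : (2 ^ r : ℝ≥0∞) * ((total stepCost l : ℕ) : ℝ≥0∞) ≤
              2 ^ r * ((6 * n * k * r : ℕ) : ℝ≥0∞) + 2 * k * costPotential χ k l := by
            exact_mod_cast hb
          calc ((total stepCost l : ℕ) : ℝ≥0∞) = (2 ^ r)⁻¹ * (2 ^ r * (total stepCost l : ℕ)) := by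
                rw [← mul_assoc, ENNReal.inv_mul_cancel h0 htop, one_mul]
            _ ≤ (2 ^ r)⁻¹ * (2 ^ r * ((6 * n * k * r : ℕ) : ℝ≥0∞) +
                2 * k * costPotential χ k l) := by gcongr
            _ = _ := by
                rw [mul_add, ← mul_assoc, ENNReal.inv_mul_cancel h0 htop, one_mul]
                ring
      _ = ((6 * n * k * r : ℕ) : ℝ≥0∞) + 2 * k * ((2 ^ r : ℝ≥0∞)⁻¹ * E) := by
          rw [ev_add, ev_const, ev_const_mul, ev_const_mul]
      _ ≤ ((6 * n * k * r : ℕ) : ℝ≥0∞) + 2 * k * 1 := by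
          gcongr
          exact hK.trans h6
      _ = ENNReal.ofReal ((6 * n * k * r + 2 * k : ℕ) : ℝ) := by
          rw [ENNReal.ofReal_natCast]
          push_cast
          ring
      _ ≤ _ := ENNReal.ofReal_le_ofReal (threshold_le h2)

end TreeBounds

/-! ### Averaging over the query graph -/

section RandomGraph

variable {V : Type u} [PartialOrder V] (μ : PMF (SimpleGraph V)) (A : PartitionAlg V)

theorem ev_partitionLaw (X : Finset V) (p : X) (Φ : SimpleGraph V × Parts p × ℕ → ℝ≥0∞) :
    ev (partitionLaw μ A X p) Φ = ev μ fun G => ev (partRun A G X p) fun t => Φ (G, t) := by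
  simp only [partitionLaw, ev_bind, ev_map]
  rfl

theorem ev_partToLELaw [Fintype V] (Φ : List V × ℕ → ℝ≥0∞) :
    ev (partToLELaw μ A) Φ = ev μ fun G => ev (sortRun A G Finset.univ) Φ := by
  simp only [partToLELaw, ev_bind]
  rfl

theorem isConvex_univ [Fintype V] : IsConvex (Finset.univ : Finset V) :=
  fun _ _ _ _ c _ _ => Finset.mem_univ c

theorem total_mul_stepCost (a : ℝ≥0∞) (l : List (Σ X : Finset V, X)) :
    total (fun X p => a * (stepCost X p : ℝ≥0∞)) l = a * (total stepCost l : ℕ) := by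
  induction l with
  | nil => simp [total_nil]
  | cons y l ih => rw [total_cons, total_cons, ih, Nat.cast_add, mul_add]

theorem ofReal_bound_eq {c x : ℝ} (hc : 0 ≤ c) (hx : 0 ≤ x) (X : Finset V) (p : X) :
    ENNReal.ofReal (c * (X.card * (width (below X p.1) + width (above X p.1)) * x)) =
      ENNReal.ofReal (c * x) * (stepCost X p : ℝ≥0∞) := by
  rw [← ENNReal.ofReal_natCast (stepCost X p), ← ENNReal.ofReal_mul (mul_nonneg hc hx), stepCost]
  push_cast
  congr 1
  ring

open Classical in
/-- The probability of a wrong output or too many queries, for a random query graph. -/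
theorem ev_partToLELaw_penalty_le [Fintype V] (hμ : ∀ G ∈ μ.support, InducesOrder G)
    (w : ∀ X : Finset V, X → ℝ≥0∞) {F : ℝ≥0∞ → ℝ≥0∞} (hF : Monotone F)
    (hF1 : ∀ x, F x ≤ 1) {δ : ℝ≥0∞}
    (hδ : ∀ X p, (ev μ fun G => failure A w G X p) ≤ δ) :
    ev (partToLELaw μ A) (penalty Finset.univ F) ≤
      ev (treeLaw (Finset.univ : Finset V)) (fun l => F (total w l)) + Fintype.card V * δ := by
  rw [ev_partToLELaw]
  refine (ev_mono_support fun G hG => ev_penalty_le A w (hμ G hG) _ isConvex_univ F hF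
    hF1).trans ?_
  rw [ev_add, ev_const, ev_meanTotal]
  gcongr
  exact (meanTotal_mono hδ _).trans (meanTotal_const δ _).le

open Classical in
theorem ev_failure (w : ∀ X : Finset V, X → ℝ≥0∞) (X : Finset V) (p : X) :
    (ev μ fun G => failure A w G X p) = (partitionLaw μ A X p).toOuterMeasure
      {r | r.2.1.Correct (inducedOn r.1 X) ∧ (r.2.2 : ℝ≥0∞) ≤ w X p}ᶜ := by
  rw [toOuterMeasure_eq_ev, ev_partitionLaw]
  simp only [failure, Set.mem_compl_iff, Set.mem_ofPred_eq, ite_not]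

theorem natCast_le_ofReal_iff {q : ℕ} {x : ℝ} (hx : 0 ≤ x) :
    (q : ℝ≥0∞) ≤ ENNReal.ofReal x ↔ (q : ℝ) ≤ x := by
  rw [← ENNReal.ofReal_natCast, ENNReal.ofReal_le_ofReal_iff hx]

theorem toOuterMeasure_compl_le {α : Type*} {P : PMF α} {s : Set α} {ε : ℝ}
    (h : ENNReal.ofReal (1 - ε) ≤ P.toOuterMeasure s) :
    P.toOuterMeasure sᶜ ≤ ENNReal.ofReal ε := by
  have h1 := toOuterMeasure_add_compl P s
  have h2 : P.toOuterMeasure sᶜ = 1 - P.toOuterMeasure s := by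
    rw [← h1, ENNReal.add_sub_cancel_left]
    exact ne_top_of_le_ne_top ENNReal.one_ne_top (h1 ▸ le_self_add)
  rw [h2, tsub_le_iff_right]
  calc (1 : ℝ≥0∞) = ENNReal.ofReal (ε + (1 - ε)) := by simp
    _ ≤ ENNReal.ofReal ε + ENNReal.ofReal (1 - ε) := ENNReal.ofReal_add_le
    _ ≤ _ := by gcongr

theorem le_toOuterMeasure_of_compl_le {α : Type*} {P : PMF α} {s : Set α} {x : ℝ} (hx : 0 ≤ x)
    (h : P.toOuterMeasure sᶜ ≤ ENNReal.ofReal x) :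
    ENNReal.ofReal (1 - x) ≤ P.toOuterMeasure s := by
  rw [ENNReal.ofReal_sub 1 hx, ENNReal.ofReal_one, tsub_le_iff_right,
    ← toOuterMeasure_add_compl P s]
  gcongr

/-- The error probability of Part-to-LE. -/
theorem ofReal_le_partToLELaw [Fintype V] (hμ : ∀ G ∈ μ.support, InducesOrder G)
    {c x ε : ℝ} (hc : 0 ≤ c) (hx : 0 ≤ x) {n k : ℕ} (hn : n = Fintype.card V)
    (hk : k = width (Finset.univ : Finset V))
    (h : ∀ (X : Finset V) (p : X), ENNReal.ofReal (1 - ε) ≤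
      (partitionLaw μ A X p).toOuterMeasure {r | r.2.1.Correct (inducedOn r.1 X) ∧
        (r.2.2 : ℝ) ≤ c * (X.card * (width (below X p.1) + width (above X p.1)) * x)}) :
    ENNReal.ofReal (1 - n * ε - 2 * (n : ℝ) ^ (-6 : ℤ)) ≤
      (partToLELaw μ A).toOuterMeasure {r | IsLinearExtension r.1 ∧
        (r.2 : ℝ) ≤ 400 * c * (n * k * x * Real.log n ^ 2)} := by
  classical
  -- A negative `ε` would demand a probability above `1`, which is impossible once there is some
  -- pair `X`, `p`; without vertices the product is `0`.
  have hε : 0 ≤ n * ε := by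
    rcases Nat.eq_zero_or_pos n with h0 | h0
    · simp [h0]
    obtain ⟨v⟩ := Fintype.card_pos_iff.1 (hn ▸ h0)
    have h1 := (h Finset.univ ⟨v, Finset.mem_univ v⟩).trans
      (le_self_add.trans (toOuterMeasure_add_compl _ _).le)
    rw [ENNReal.ofReal_le_one] at h1
    have : 0 ≤ ε := by linarith
    positivity
  have hn6 : 0 ≤ 2 * (n : ℝ) ^ (-6 : ℤ) := by positivity
  have hB : 0 ≤ 400 * c * (n * k * x * Real.log n ^ 2) := by positivity
  rw [sub_sub]
  refine le_toOuterMeasure_of_compl_le (add_nonneg hε hn6) ?_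
  let w : ∀ X : Finset V, X → ℝ≥0∞ := fun X p => ENNReal.ofReal (c * x) * (stepCost X p : ℝ≥0∞)
  let F : ℝ≥0∞ → ℝ≥0∞ := fun y =>
    if y ≤ ENNReal.ofReal (400 * c * (n * k * x * Real.log n ^ 2)) then 0 else 1
  have hF : Monotone F := by
    intro y z hyz
    simp only [F]
    split_ifs with h1 h2
    exacts [le_rfl, zero_le, absurd (hyz.trans ‹_›) h1, le_rfl]
  have hF1 : ∀ y, F y ≤ 1 := by
    intro y
    simp only [F]
    split_ifs
    exacts [zero_le, le_rfl]
  have hδ : ∀ X p, (ev μ fun G => failure A w G X p) ≤ ENNReal.ofReal ε := by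
    intro X p
    rw [ev_failure]
    refine toOuterMeasure_compl_le ?_
    convert h X p using 5 with r
    change _ ≤ ENNReal.ofReal (c * x) * (stepCost X p : ℝ≥0∞) ↔ _
    rw [← ofReal_bound_eq hc hx, natCast_le_ofReal_iff (by positivity)]
  have key := ev_partToLELaw_penalty_le μ A hμ w hF hF1 hδ
  have htree : ev (treeLaw (Finset.univ : Finset V)) (fun l => F (total w l)) ≤
      ENNReal.ofReal (2 * (n : ℝ) ^ (-6 : ℤ)) := by
    refine le_trans (ev_mono fun l => ?_) (ev_total_stepCost_gt_le hn hk)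
    split_ifs with hl
    · simp only [F, w]
      rw [total_mul_stepCost, if_pos]
      rw [← ENNReal.ofReal_natCast, ← ENNReal.ofReal_mul (by positivity)]
      refine ENNReal.ofReal_le_ofReal ?_
      calc c * x * ((total stepCost l : ℕ) : ℝ) ≤
            c * x * (400 * (n * k * Real.log n ^ 2)) := by gcongr
        _ = _ := by ring
    · exact hF1 _
  rw [toOuterMeasure_eq_ev]
  refine le_trans (ev_mono fun r => ?_) (key.trans ?_)
  · split_ifs with hr
    · rw [penalty]
      split_ifs with hle
      · simp only [F]
        rw [if_neg]
        rw [natCast_le_ofReal_iff hB]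
        exact fun hq => hr ⟨isLinearExtension_of_univ hle, hq⟩
      · exact le_rfl
    · exact zero_le
  · rw [ENNReal.ofReal_add hε hn6, ENNReal.ofReal_mul (Nat.cast_nonneg n),
      ENNReal.ofReal_natCast, add_comm, ← hn]
    gcongr

theorem correct_of_mem_partRun
    (h : ∀ (X : Finset V) (p : X), ∀ r ∈ (partitionLaw μ A X p).support,
      r.2.1.Correct (inducedOn r.1 X))
    {G : SimpleGraph V} (hG : G ∈ μ.support) (X : Finset V) (p : X) {t : Parts p × ℕ}
    (ht : t ∈ (partRun A G X p).support) : t.1.Correct (inducedOn G X) := by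
  refine h X p (G, t) ?_
  rw [partitionLaw, PMF.mem_support_bind_iff]
  refine ⟨G, hG, ?_⟩
  rw [PMF.mem_support_map_iff]
  exact ⟨t, ht, rfl⟩

/-- Part-to-LE is always correct if the partition procedure is. -/
theorem isLinearExtension_of_mem_support [Fintype V] (hμ : ∀ G ∈ μ.support, InducesOrder G)
    (h : ∀ (X : Finset V) (p : X), ∀ r ∈ (partitionLaw μ A X p).support,
      r.2.1.Correct (inducedOn r.1 X))
    {r : List V × ℕ} (hr : r ∈ (partToLELaw μ A).support) : IsLinearExtension r.1 := by
  -- With `F = 0` and no limit on queries, the penalty is the indicator of a wrong output and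
  -- failures have probability `0`. Zero expectation then gives correctness on the whole support.
  have key := ev_partToLELaw_penalty_le μ A hμ (fun _ _ => ⊤) (F := fun _ => 0)
    monotone_const (fun _ => zero_le) (δ := 0) fun X p => by
      rw [ev_failure, nonpos_iff_eq_zero, PMF.toOuterMeasure_apply_eq_zero_iff,
        Set.disjoint_compl_right_iff_subset]
      exact fun r hr => ⟨h X p r hr, le_top⟩
  rw [ev_const, mul_zero, add_zero, nonpos_iff_eq_zero, ev, ENNReal.tsum_eq_zero] at key
  have hz := (mul_eq_zero.1 (key r)).resolve_left ((PMF.mem_support_iff _ _).1 hr)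
  by_contra hno
  rw [penalty, if_neg fun h => hno (isLinearExtension_of_univ h)] at hz
  exact one_ne_zero hz

/-- The expected number of queries of Part-to-LE. -/
theorem expect_partToLELaw_le [Fintype V] (hμ : ∀ G ∈ μ.support, InducesOrder G)
    {c x : ℝ} (hc : 0 ≤ c) (hx : 0 ≤ x) {n k : ℕ} (hn : n = Fintype.card V)
    (hk : k = width (Finset.univ : Finset V))
    (h : ∀ (X : Finset V) (p : X), ∀ r ∈ (partitionLaw μ A X p).support,
      r.2.1.Correct (inducedOn r.1 X))
    (hq : ∀ (X : Finset V) (p : X), expect (partitionLaw μ A X p) (fun r => r.2.2) ≤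
      ENNReal.ofReal (c * (X.card * (width (below X p.1) + width (above X p.1)) * x))) :
    expect (partToLELaw μ A) (fun r => r.2) ≤
      ENNReal.ofReal (400 * c * (n * k * x * Real.log n ^ 2)) := by
  have hw : ∀ X p, (ev μ fun G => ev (partRun A G X p) fun t => (t.2 : ℝ≥0∞)) ≤
      ENNReal.ofReal (c * x) * (stepCost X p : ℝ≥0∞) := by
    intro X p
    rw [← ofReal_bound_eq hc hx, ← ev_partitionLaw μ A X p fun r => (r.2.2 : ℝ≥0∞)]
    exact hq X p
  calc expect (partToLELaw μ A) (fun r => r.2)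
      = ev μ fun G => ev (sortRun A G Finset.univ) fun s => (s.2 : ℝ≥0∞) :=
        ev_partToLELaw μ A fun r => (r.2 : ℝ≥0∞)
    _ ≤ ev μ fun G => meanTotal (fun X p => ev (partRun A G X p) fun t => (t.2 : ℝ≥0∞))
          Finset.univ :=
        ev_mono_support fun G hG => ev_queries_le A (hμ G hG)
          (fun X p t ht => correct_of_mem_partRun μ A h hG X p ht) _ isConvex_univ
    _ = meanTotal (fun X p => ev μ fun G => ev (partRun A G X p) fun t => (t.2 : ℝ≥0∞))
          Finset.univ := ev_meanTotal μ _ _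
    _ ≤ meanTotal (fun X p => ENNReal.ofReal (c * x) * (stepCost X p : ℝ≥0∞)) Finset.univ :=
        meanTotal_mono hw _
    _ = ENNReal.ofReal (c * x) * ev (treeLaw (Finset.univ : Finset V))
          (fun l => ((total stepCost l : ℕ) : ℝ≥0∞)) := by
        rw [meanTotal, ← ev_const_mul]
        exact congrArg _ (funext fun l => total_mul_stepCost _ l)
    _ ≤ ENNReal.ofReal (c * x) * ENNReal.ofReal (400 * (n * k * Real.log n ^ 2)) := by
        gcongr
        exact ev_total_stepCost_le hn hk
    _ = _ := by
        rw [← ENNReal.ofReal_mul (by positivity)]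
        congr 1
        ring

end RandomGraph

end PosetSort

end

theorem lemma3p3 :
    ∀ c : ℝ, 0 < c → ∃ C : ℝ, 0 < C ∧
      ∀ (V : Type u) [Fintype V] [PartialOrder V]
        (μ : PMF (SimpleGraph V)) (A : PosetSort.PartitionAlg V)
        (f : ℕ → ℕ → ℝ) (n k : ℕ),
        (∀ G ∈ μ.support, PosetSort.InducesOrder G) →
        (∀ a b, 0 ≤ f a b) →
        n = Fintype.card V →
        k = PosetSort.width (Finset.univ : Finset V) →
        -- error probability and worst-case bound on success
        (∀ ε : ℝ,
          (∀ (X : Finset V) (p : X),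
            ENNReal.ofReal (1 - ε) ≤ (PosetSort.partitionLaw μ A X p).toOuterMeasure
              {r | r.2.1.Correct (PosetSort.inducedOn r.1 X) ∧
                (r.2.2 : ℝ) ≤ c * (X.card *
                  (PosetSort.width (PosetSort.below X p) +
                    PosetSort.width (PosetSort.above X p)) * f n k)}) →
          ENNReal.ofReal (1 - n * ε - 2 * (n : ℝ) ^ (-6 : ℤ)) ≤
            (PosetSort.partToLELaw μ A).toOuterMeasure
              {r | PosetSort.IsLinearExtension r.1 ∧
                (r.2 : ℝ) ≤ C * (n * k * f n k * Real.log n ^ 2)}) ∧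
        -- always correct, with a bound in expectation
        ((∀ (X : Finset V) (p : X),
            (∀ r ∈ (PosetSort.partitionLaw μ A X p).support,
              r.2.1.Correct (PosetSort.inducedOn r.1 X)) ∧
            PosetSort.expect (PosetSort.partitionLaw μ A X p) (fun r => r.2.2) ≤
              ENNReal.ofReal (c * (X.card *
                (PosetSort.width (PosetSort.below X p) +
                  PosetSort.width (PosetSort.above X p)) * f n k))) →
          (∀ r ∈ (PosetSort.partToLELaw μ A).support, PosetSort.IsLinearExtension r.1) ∧
          PosetSort.expect (PosetSort.partToLELaw μ A) (fun r => r.2) ≤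
            ENNReal.ofReal (C * (n * k * f n k * Real.log n ^ 2))) := by
  intro c hc
  refine ⟨400 * c, by positivity, ?_⟩
  intro V _ _ μ A f n k hμ hf hn hk
  refine ⟨fun ε h => PosetSort.ofReal_le_partToLELaw μ A hμ hc.le (hf n k) hn hk h, fun h => ?_⟩
  exact ⟨fun r hr => PosetSort.isLinearExtension_of_mem_support μ A hμ (fun X p => (h X p).1) hr,
    PosetSort.expect_partToLELaw_le μ A hμ hc.le (hf n k) hn hk (fun X p => (h X p).1)
      fun X p => (h X p).2⟩
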